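/- Let $\log$ denote the base-$2$ logarithm. For a finite simple graph $G$ with vertex set $V$, $n = |V|$, let $\mathrm{STAB}(G) \subseteq \mathbb{R}^V$ be the convex hull of the characteristic vectors of the stable (independent) sets of $G$, and let $$H(G) = \min_{x \in \mathrm{STAB}(G),\ x > 0} \; -\frac{1}{n}\sum_{v \in V} \log x_v$$ be the (Körner) entropy of $G$. For a finite poset $P$, let $\overline{G}(P)$ be its incomparability graph (the vertices are the elements of $P$, and two of them are adjacent if and only if they are incomparable), let $e(P)$ be the number of linear extensions of $P$, and let $\kappa_2(P)$ be the number of connected components of $\overline{G}(P)$ that have exactly two vertices. Let $P$ be a finite poset of width $2$, that is, the largest antichains of $P$ have exactly two elements. Then $$|P| \cdot H(\overline{G}(P)) \le (2-\varepsilon)\,\log e(P) + \varepsilon\,\kappa_2(P),$$ where $\varepsilon = 2 - \dfrac{3\log 3 - 2}{\log 3} \approx 0.26$ (rounded to two decimals). -/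

import Mathlib

noncomputable section

namespace PosetEntropy

/-- The stable set polytope of `G`: the convex hull in `ℝ^V` of the characteristic vectors of the
stable (independent) sets of `G`. -/
def stab {V : Type*} (G : SimpleGraph V) : Set (V → ℝ) :=
  convexHull ℝ {x : V → ℝ | ∃ S : Set V, G.IsIndepSet S ∧ x = S.indicator 1}

/-- The function minimized in the definition of graph entropy:
`f(x) = - ∑ v, (1 / n) * log x_v` with `n = |V|` and base-2 logarithm. -/
def entropyObjective {V : Type*} [Fintype V] (x : V → ℝ) : ℝ :=
  -∑ v, (1 / (Fintype.card V : ℝ)) * Real.logb 2 (x v)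

/-- The (Körner) entropy of a finite graph with the uniform distribution on its vertices: the
minimum of `entropyObjective` over the points of the stable set polytope with positive coordinates.
That the infimum is a minimum is `graphEntropy_isLeast`. -/
def graphEntropy {V : Type*} [Fintype V] (G : SimpleGraph V) : ℝ :=
  sInf (entropyObjective '' {x : V → ℝ | x ∈ stab G ∧ ∀ v, 0 < x v})

theorem isCompact_stab {V : Type*} [Fintype V] (G : SimpleGraph V) : IsCompact (stab G) := by
  have h : {x : V → ℝ | ∃ S : Set V, G.IsIndepSet S ∧ x = S.indicator 1}.Finite := by
    refine (Set.finite_range (fun S : Set V => (S.indicator 1 : V → ℝ))).subset ?_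
    rintro x ⟨S, -, rfl⟩
    exact ⟨S, rfl⟩
  exact h.isCompact_convexHull ℝ

theorem exists_pos_mem_stab {V : Type*} [Fintype V] (G : SimpleGraph V) :
    ∃ x ∈ stab G, ∀ v, 0 < x v := by
  classical
  rcases isEmpty_or_nonempty V with hV | hV
  · exact ⟨(∅ : Set V).indicator 1, subset_convexHull ℝ _ ⟨∅, by simp [SimpleGraph.IsIndepSet], rfl⟩,
      fun v => (IsEmpty.false v).elim⟩
  · have hn : (0 : ℝ) < Fintype.card V := by exact_mod_cast Fintype.card_pos
    refine ⟨∑ v : V, ((Fintype.card V : ℝ)⁻¹) • (({v} : Set V).indicator 1 : V → ℝ), ?_, ?_⟩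
    · refine (convex_convexHull ℝ _).sum_mem (fun _ _ => by positivity) ?_ ?_
      · simp [hn.ne']
      · intro v _
        exact subset_convexHull ℝ _ ⟨{v}, by simp [SimpleGraph.IsIndepSet], rfl⟩
    · intro w
      have : (∑ v : V, ((Fintype.card V : ℝ)⁻¹) • (({v} : Set V).indicator 1 : V → ℝ)) w
          = (Fintype.card V : ℝ)⁻¹ := by
        simp [Finset.sum_apply, Pi.single_apply]
      rw [this]
      positivity

theorem nonneg_of_mem_stab {V : Type*} (G : SimpleGraph V) {x : V → ℝ} (hx : x ∈ stab G) (v : V) :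
    0 ≤ x v := by
  have h : stab G ⊆ {x : V → ℝ | 0 ≤ x} := by
    refine convexHull_min ?_ (convex_Ici (0 : V → ℝ))
    rintro x ⟨S, -, rfl⟩
    exact fun v => Set.indicator_nonneg (fun _ _ => zero_le_one) v
  exact h hx v

/-- The minimum in the definition of graph entropy is attained. -/
theorem graphEntropy_isLeast {V : Type*} [Fintype V] (G : SimpleGraph V) :
    IsLeast (entropyObjective '' {x : V → ℝ | x ∈ stab G ∧ ∀ v, 0 < x v}) (graphEntropy G) := by
  obtain ⟨y, hy, hypos⟩ := exists_pos_mem_stab G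
  obtain ⟨x, hx, hmax⟩ := (isCompact_stab G).exists_isMaxOn ⟨y, hy⟩
    (f := fun x : V → ℝ => ∏ v, x v) (by fun_prop)
  have hprod : 0 < ∏ v, x v := lt_of_lt_of_le (Finset.prod_pos fun v _ => hypos v) (hmax hy)
  have hxpos : ∀ v, 0 < x v := fun v =>
    lt_of_le_of_ne (nonneg_of_mem_stab G hx v) fun h0 =>
      hprod.ne' (Finset.prod_eq_zero (Finset.mem_univ v) h0.symm)
  have hobj : ∀ z : V → ℝ, (∀ v, 0 < z v) →
      entropyObjective z = -((1 / (Fintype.card V : ℝ)) * Real.logb 2 (∏ v, z v)) := by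
    intro z hz
    rw [entropyObjective, ← Finset.mul_sum, Real.logb_prod]
    exact fun v _ => (hz v).ne'
  have hle : IsLeast (entropyObjective '' {x : V → ℝ | x ∈ stab G ∧ ∀ v, 0 < x v})
      (entropyObjective x) := by
    refine ⟨⟨x, ⟨hx, hxpos⟩, rfl⟩, ?_⟩
    rintro _ ⟨z, ⟨hz, hzpos⟩, rfl⟩
    rw [hobj x hxpos, hobj z hzpos]
    have h1 : Real.logb 2 (∏ v, z v) ≤ Real.logb 2 (∏ v, x v) :=
      Real.logb_le_logb_of_le (by norm_num) (Finset.prod_pos fun v _ => hzpos v) (hmax hz)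
    exact neg_le_neg (mul_le_mul_of_nonneg_left h1 (by positivity))
  have heq : graphEntropy G = entropyObjective x := hle.csInf_eq
  rw [heq]
  exact hle

/-- The incomparability graph of a poset: distinct elements are adjacent when neither is below the
other. -/
def incompGraph (P : Type*) [PartialOrder P] : SimpleGraph P where
  Adj a b := IncompRel (· ≤ ·) a b
  symm := ⟨fun _ _ h => h.symm⟩
  loopless := ⟨fun _ h => h.1 le_rfl⟩

/-- The number `e(P)` of linear extensions of `P`, i.e. of linear orders on the ground set of `P`
that contain the order of `P`. -/
def numLinearExtensions (P : Type*) [PartialOrder P] : ℕ :=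
  Nat.card {r : P → P → Prop // IsLinearOrder P r ∧ ∀ a b, a ≤ b → r a b}

/-- The poset `P` has width `k`: the largest antichains of `P` have exactly `k` elements. -/
def HasWidth (P : Type*) [PartialOrder P] (k : ℕ) : Prop :=
  IsGreatest {m : ℕ | ∃ A : Finset P, IsAntichain (· ≤ ·) (A : Set P) ∧ A.card = m} k

/-- The number `κ₂(P)` of connected components with exactly two vertices of the incomparability
graph of `P`. -/
def kappaTwo (P : Type*) [PartialOrder P] : ℕ :=
  Nat.card {C : (incompGraph P).ConnectedComponent // C.supp.ncard = 2}

/-- The constant `ε = 2 - (3 log 3 - 2) / log 3`, with base-2 logarithms. -/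
def eps : ℝ :=
  2 - (3 * Real.logb 2 3 - 2) / Real.logb 2 3

end PosetEntropy

end

/-! Width 2 makes the incomparability graph bipartite (`HasWidth.exists_coloring`), and then every
vector with entries in [0, 1] and x u + x v ≤ 1 on all edges lies in the stable set polytope
(`mem_stab_of_coloring`). The components are linearly ordered by P, so the product of their numbers
of linear extensions is at most e(P) (`prod_numLinearExtensions_le`). Hence it suffices to find on
each component a feasible vector of cost at most (2 - ε) log e, plus ε if the component is a pair.

On a component with at least two vertices let x maximize the product of the entries under the edge
constraints, and lay out each of the two chains as consecutive intervals of lengths 1 / x v.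
First-order optimality (`IsOptimal.sum_inv_le`) makes the two tilings equally long, and overlapping
intervals belong to incomparable elements whose entries sum to 1 (`TwoChains.overlap`). So the
picture consists of stars, where a long interval (x ≤ 1/3) faces several short ones, and of
stretches with all entries in (1/3, 2/3). A symmetric monotone rounding keeps x feasible, turns the
middle entries into 1/2, and leaves a discrete family of star costs.

It remains to bound the product of the weights (1 / rounded x) ^ (1 / (2 - ε)) by e. The induction
`Layout.boundedBelow` reads the tilings from left to right and compares the weight R of a prefix
with X and Y, the numbers of its linear extensions with one or the other last element on top; these
grow as in Pascal's triangle. The star with two leaves has cost 3 log 3 - 2 and three linear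
extensions, and this equality case fixes ε. The only exception is a lone pair, with cost 2 and log e
= 1. In a larger connected component the extra incomparabilities around such a pair make up for it.
-/

namespace PosetEntropy

/-! ### Pairs of tilings and their prefix counts -/

/-- Two sequences of lengths `1 / α i` (`i < p`) and `1 / β j` (`j < q`) that tile the same
interval, together with an incomparability relation and a counting function of prefixes. -/
structure Layout where
  p : ℕ
  q : ℕ
  α : ℕ → ℝ
  β : ℕ → ℝ
  inc : ℕ → ℕ → Prop
  N : ℕ → ℕ → ℝ
  p_pos : 0 < p
  q_pos : 0 < q
  α_pos : ∀ i, 0 < α i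
  β_pos : ∀ j, 0 < β j
  overlap : ∀ i j, i < p → j < q →
    ∑ k ∈ Finset.range i, 1 / α k < ∑ k ∈ Finset.range (j + 1), 1 / β k →
    ∑ k ∈ Finset.range j, 1 / β k < ∑ k ∈ Finset.range (i + 1), 1 / α k →
    inc i j ∧ α i + β j = 1
  total : ∑ k ∈ Finset.range p, 1 / α k = ∑ k ∈ Finset.range q, 1 / β k
  link : ∀ i j, i + 1 < p → j + 1 < q → inc i j → inc (i + 1) j ∨ inc i (j + 1)
  one_le : ∀ i j, 1 ≤ N i j
  split : ∀ i j, i < p → j < q → inc i j → N i (j + 1) + N (i + 1) j ≤ N (i + 1) (j + 1)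
  mono_left : ∀ i j, i < p → j < q → inc i j → N i j ≤ N (i + 1) j
  mono_right : ∀ i j, i < p → j < q → inc i j → N i j ≤ N i (j + 1)

namespace Layout

/-- The left endpoint of the `i`-th interval of the first tiling. -/
noncomputable def A (L : Layout) (i : ℕ) : ℝ := ∑ k ∈ Finset.range i, 1 / L.α k

/-- The left endpoint of the `j`-th interval of the second tiling. -/
noncomputable def B (L : Layout) (j : ℕ) : ℝ := ∑ k ∈ Finset.range j, 1 / L.β k

/-- The layout with the two tilings exchanged. -/
def swap (L : Layout) : Layout where
  p := L.q
  q := L.p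
  α := L.β
  β := L.α
  inc := fun j i => L.inc i j
  N := fun j i => L.N i j
  p_pos := L.q_pos
  q_pos := L.p_pos
  α_pos := L.β_pos
  β_pos := L.α_pos
  overlap := fun j i hj hi h1 h2 => by
    obtain ⟨h3, h4⟩ := L.overlap i j hi hj h2 h1
    exact ⟨h3, by rw [add_comm]; exact h4⟩
  total := L.total.symm
  link := fun j i hj hi h => (L.link i j hi hj h).symm
  one_le := fun j i => L.one_le i j
  split := fun j i hj hi h => by rw [add_comm]; exact L.split i j hi hj h
  mono_left := fun j i hj hi h => L.mono_right i j hi hj h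
  mono_right := fun j i hj hi h => L.mono_left i j hi hj h

variable (L : Layout)

theorem A_succ (i : ℕ) : L.A (i + 1) = L.A i + 1 / L.α i := Finset.sum_range_succ _ _

theorem B_succ (j : ℕ) : L.B (j + 1) = L.B j + 1 / L.β j := Finset.sum_range_succ _ _

theorem A_lt_succ (i : ℕ) : L.A i < L.A (i + 1) := by
  rw [A_succ]; have := L.α_pos i; linarith [one_div_pos.2 this]

theorem B_lt_succ (j : ℕ) : L.B j < L.B (j + 1) := L.swap.A_lt_succ j

theorem A_strictMono : StrictMono L.A := strictMono_nat_of_lt_succ L.A_lt_succ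

theorem B_strictMono : StrictMono L.B := L.swap.A_strictMono

theorem A_p : L.A L.p = L.B L.q := L.total

theorem lt_q_of_B_lt {i j : ℕ} (hi : i ≤ L.p) (h : L.B j < L.A i) : j < L.q := by
  have h1 : L.A i ≤ L.A L.p := L.A_strictMono.monotone hi
  rw [A_p] at h1
  exact L.B_strictMono.lt_iff_lt.1 (h.trans_le h1)

theorem lt_p_of_A_lt {i j : ℕ} (hj : j ≤ L.q) (h : L.A i < L.B j) : i < L.p :=
  L.swap.lt_q_of_B_lt hj h

theorem overlap' {i j : ℕ} (hi : i < L.p) (hj : j < L.q) (h1 : L.A i < L.B (j + 1))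
    (h2 : L.B j < L.A (i + 1)) : L.inc i j ∧ L.α i + L.β j = 1 := L.overlap i j hi hj h1 h2

/-- The number of linear extensions of a prefix that end with the `i`-th element of the first
chain. -/
def X (i j : ℕ) : ℝ := L.N i (j + 1)

/-- The number of linear extensions of a prefix that end with the `j`-th element of the second
chain. -/
def Y (i j : ℕ) : ℝ := L.N (i + 1) j

theorem one_le_X (i j : ℕ) : 1 ≤ L.X i j := L.one_le _ _

theorem one_le_Y (i j : ℕ) : 1 ≤ L.Y i j := L.one_le _ _

theorem X_add_Y_le_N {i j : ℕ} (hi : i < L.p) (hj : j < L.q) (h : L.inc i j) :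
    L.X i j + L.Y i j ≤ L.N (i + 1) (j + 1) := L.split i j hi hj h

theorem X_succ_right {i j : ℕ} (hi : i < L.p) (hj : j + 1 < L.q)
    (h' : L.inc i (j + 1)) : L.X i j ≤ L.X i (j + 1) := L.mono_right i (j + 1) hi hj h'

theorem Y_succ_right {i j : ℕ} (hi : i < L.p) (hj : j < L.q) (h : L.inc i j) :
    L.X i j + L.Y i j ≤ L.Y i (j + 1) := L.split i j hi hj h

theorem Y_succ_left {i j : ℕ} (hi : i + 1 < L.p) (hj : j < L.q)
    (h' : L.inc (i + 1) j) : L.Y i j ≤ L.Y (i + 1) j := L.mono_left (i + 1) j hi hj h'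

theorem X_succ_left {i j : ℕ} (hi : i < L.p) (hj : j < L.q) (h : L.inc i j) :
    L.X i j + L.Y i j ≤ L.X (i + 1) j := L.split i j hi hj h

/-- The weight of the prefix formed by `i` elements of the first and `j` elements of the second
chain. -/
def R (w : ℝ → ℝ) (i j : ℕ) : ℝ :=
  (∏ k ∈ Finset.range i, w (L.α k)) * ∏ k ∈ Finset.range j, w (L.β k)

theorem R_succ_left (w : ℝ → ℝ) (i j : ℕ) : L.R w (i + 1) j = L.R w i j * w (L.α i) := by
  rw [R, R, Finset.prod_range_succ]; ring

theorem R_succ_right (w : ℝ → ℝ) (i j : ℕ) : L.R w i (j + 1) = L.R w i j * w (L.β j) := by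
  rw [R, R, Finset.prod_range_succ]; ring

theorem R_swap (w : ℝ → ℝ) (i j : ℕ) : L.swap.R w j i = L.R w i j := mul_comm _ _

/-! ### Weights and the left-to-right induction -/

/-- The properties of the weights used in the comparison with the number of linear extensions. -/
structure Weight (w : ℝ → ℝ) (r : ℝ) : Prop where
  pos : ∀ x, 0 < w x
  half : ∀ x, 1 / 3 < x → x < 2 / 3 → w x = r
  two_le : 2 ≤ r ^ 2
  le_five : r ^ 4 ≤ 5
  r_pos : 0 < r
  star : ∀ (x : ℝ) (m : ℕ), 0 < x → x ≤ 1 / 3 → 1 / x - 2 < m → m < 1 / x →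
    w x * w (1 - x) ^ m ≤ m + 1 ∧ r ^ 2 * (w x * w (1 - x) ^ m) ≤ 2 * m + 3 ∧
      r ^ 4 * (w x * w (1 - x) ^ m) ≤ 4 * m + 8

variable {w : ℝ → ℝ} {r : ℝ}

theorem R_pos (hw : Weight w r) (i j : ℕ) : 0 < L.R w i j :=
  mul_pos (Finset.prod_pos fun _ _ => hw.pos _) (Finset.prod_pos fun _ _ => hw.pos _)

/-- Decimal bounds above the powers of 5 with exponents 1/2, and below 1/4 and 3/4. The alternating
case needs them to stay under 5/2, 3/2 and 7/2 respectively. -/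
theorem Weight.sq_le (hw : Weight w r) : r ^ 2 ≤ 2237 / 1000 := by
  nlinarith [hw.le_five, hw.two_le]

theorem Weight.le (hw : Weight w r) : r ≤ 1496 / 1000 := by
  nlinarith [hw.sq_le, hw.r_pos]

theorem Weight.cube_le (hw : Weight w r) : r ^ 3 ≤ 34 / 10 := by
  have h1 := hw.sq_le
  have h2 := hw.le
  have h3 := hw.r_pos
  have h4 := hw.two_le
  have : r ^ 3 = r ^ 2 * r := by ring
  rw [this]
  nlinarith

/-- The state of the comparison after a completed piece. -/
def Good (w : ℝ → ℝ) (r : ℝ) (i j : ℕ) : Prop :=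
  L.R w (i + 1) (j + 1) ≤ L.X i j + L.Y i j ∧
  r ^ 2 * L.R w (i + 1) (j + 1) ≤ 3 * L.X i j + 2 * L.Y i j ∧
  r ^ 2 * L.R w (i + 1) (j + 1) ≤ 2 * L.X i j + 3 * L.Y i j

/-- The state of the comparison when two intervals have just been opened at a common endpoint:
either nothing precedes them, or only an isolated pair does, or what precedes is good. -/
def Opened (w : ℝ → ℝ) (r : ℝ) (i j : ℕ) : Prop :=
  (L.R w i j = 1 ∧ i = 0 ∧ j = 0) ∨
  (L.R w i j = r ^ 2 ∧ 2 ≤ L.X i j ∧ 2 ≤ L.Y i j ∧ 5 ≤ L.X i j + L.Y i j) ∨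
  (L.R w i j ≤ L.X i j ∧ L.R w i j ≤ L.Y i j ∧ r ^ 2 * L.R w i j ≤ L.X i j + L.Y i j)

theorem Opened.swap {i j : ℕ} (h : L.Opened w r i j) : L.swap.Opened w r j i := by
  unfold Opened at h ⊢
  rw [R_swap]
  have e1 : L.swap.X j i = L.Y i j := rfl
  have e2 : L.swap.Y j i = L.X i j := rfl
  rw [e1, e2]
  rcases h with ⟨h1, h2, h3⟩ | ⟨h1, h2, h3, h4⟩ | ⟨h1, h2, h3⟩
  · exact Or.inl ⟨h1, h3, h2⟩
  · exact Or.inr (Or.inl ⟨h1, h3, h2, by linarith⟩)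
  · exact Or.inr (Or.inr ⟨h2, h1, by linarith⟩)

/-- The comparison to be proved. -/
def Bounded (w : ℝ → ℝ) : Prop := (L.p = 1 ∧ L.q = 1) ∨ L.R w L.p L.q ≤ L.N L.p L.q

theorem Bounded.of_swap (h : L.swap.Bounded w) : L.Bounded w := by
  rcases h with ⟨h1, h2⟩ | h
  · exact Or.inl ⟨h2, h1⟩
  · right
    have := L.R_swap w L.p L.q
    exact this ▸ h

/-- Running through the intervals of the second tiling that start inside the `i`-th interval of the
first one. -/
theorem exists_run (w : ℝ → ℝ) {i : ℕ} (hi : i < L.p) : ∀ (n j : ℕ), L.q - j ≤ n → j < L.q →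
    L.A i < L.B (j + 1) → L.B j < L.A (i + 1) →
    ∃ k, j + k < L.q ∧ L.inc i (j + k) ∧ L.B (j + k) < L.A (i + 1) ∧
      L.A (i + 1) ≤ L.B (j + k + 1) ∧ L.β (j + k) = 1 - L.α i ∧
      L.B (j + k) = L.B j + k * (1 / (1 - L.α i)) ∧
      L.B (j + k + 1) = L.B j + (k + 1) * (1 / (1 - L.α i)) ∧
      L.R w (i + 1) (j + k + 1) = L.R w (i + 1) (j + 1) * w (1 - L.α i) ^ k ∧
      L.X i j ≤ L.X i (j + k) ∧ L.Y i j + k * L.X i j ≤ L.Y i (j + k) := by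
  intro n
  induction n with
  | zero => intro j h1 h2; omega
  | succ n ih =>
    intro j h1 h2 h3 h4
    obtain ⟨hI, hs⟩ := L.overlap' hi h2 h3 h4
    have hb : L.β j = 1 - L.α i := by linarith
    rcases le_or_gt (L.A (i + 1)) (L.B (j + 1)) with h5 | h5
    · refine ⟨0, by simpa using h2, hI, h4, h5, hb, by simp, ?_, by simp, by simp, by simp⟩
      rw [add_zero, B_succ, hb]; simp
    · have h6 : j + 1 < L.q := L.lt_q_of_B_lt hi h5
      obtain ⟨k, g1, g2, g3, g4, g5, g6, g7, g8, g9, g10⟩ :=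
        ih (j + 1) (by omega) h6 (h3.trans (L.B_lt_succ _)) h5
      have hI' := (L.overlap' hi h6 (h3.trans (L.B_lt_succ _)) h5).1
      have e : j + 1 + k = j + (k + 1) := by ring
      rw [e] at g1 g2 g3 g4 g5 g6 g7 g8 g9 g10
      have x1 := L.X_succ_right hi h6 hI'
      have y1 := L.Y_succ_right hi h2 hI
      have hb' : L.β (j + 1) = 1 - L.α i := by
        linarith [(L.overlap' hi h6 (h3.trans (L.B_lt_succ _)) h5).2]
      refine ⟨k + 1, g1, g2, g3, g4, g5, ?_, ?_, ?_, x1.trans g9, ?_⟩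
      · rw [g6, B_succ, hb]; push_cast; ring
      · rw [g7, B_succ, hb]; push_cast; ring
      · rw [g8, R_succ_right, hb', pow_succ]; ring
      · push_cast
        have : (k : ℝ) * L.X i j ≤ k * L.X i (j + 1) :=
          mul_le_mul_of_nonneg_left x1 (Nat.cast_nonneg k)
        linarith

/-- The induction hypothesis of the comparison: it holds from each state with less than `n`
remaining elements. -/
def BoundedBelow (w : ℝ → ℝ) (r : ℝ) (n : ℕ) : Prop :=
  ∀ (L : Layout) (i j : ℕ), i < L.p → j < L.q → L.inc i j → (L.p - i) + (L.q - j) < n →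
    (L.A i = L.B j → L.Opened w r i j → L.Bounded w) ∧
    (L.B j < L.A (i + 1) → L.A (i + 1) < L.B (j + 1) → L.β j ≥ 2 / 3 → L.Good w r i j →
      L.Bounded w) ∧
    (L.B j < L.A i → L.A i < L.B (j + 1) → 1 / 3 < L.α i → L.α i < 1 / 2 →
      L.R w (i + 1) (j + 1) ≤ 2 * L.X i j → L.R w (i + 1) (j + 1) ≤ L.X i j + L.Y i j → L.Bounded w)

variable {n : ℕ}

/-- After a common endpoint the next two elements are again incomparable, and `link` adds an
incomparable pair across the endpoint. Depending on its side, the next X + Y is at least 2X + 3Y or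
3X + 2Y, which is what the last two clauses of `Good` anticipate. After a lone pair it is at least
5. -/
theorem bounded_of_tie (ih : BoundedBelow w r n) {i j : ℕ} (hi : i < L.p) (hj : j < L.q)
    (hI : L.inc i j) (hn : (L.p - i) + (L.q - j) < n + 1) (h : L.A (i + 1) = L.B (j + 1))
    (hs : L.Good w r i j ∨ (i = 0 ∧ j = 0 ∧ L.R w 1 1 = r ^ 2)) : L.Bounded w := by
  rcases Nat.lt_or_ge (i + 1) L.p with hi' | hi'
  · have hj' : j + 1 < L.q := by
      have h1 : L.A (i + 1) < L.A L.p := L.A_strictMono hi'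
      rw [A_p, h] at h1
      exact L.B_strictMono.lt_iff_lt.1 h1
    have hI' := (L.overlap' hi' hj' (h ▸ L.B_lt_succ _) (h ▸ L.A_lt_succ _)).1
    have key : (L.R w (i + 1) (j + 1) ≤ L.X i j + L.Y i j ∧
        r ^ 2 * L.R w (i + 1) (j + 1) ≤ 3 * L.X i j + 2 * L.Y i j ∧
        r ^ 2 * L.R w (i + 1) (j + 1) ≤ 2 * L.X i j + 3 * L.Y i j) ∨
        L.R w (i + 1) (j + 1) = r ^ 2 := by
      rcases hs with hs | ⟨rfl, rfl, hs⟩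
      · exact Or.inl hs
      · exact Or.inr hs
    refine (ih L (i + 1) (j + 1) hi' hj' hI' (by omega)).1 h ?_
    have hX := L.one_le_X i j
    have hY := L.one_le_Y i j
    unfold Opened
    rcases L.link i j hi' hj' hI with hl | hl
    · have x1 := L.X_succ_left hi hj hI
      have y1 := L.Y_succ_left hi' hj hl
      have x2 := L.X_succ_right hi' hj' hI'
      have y2 := L.Y_succ_right hi' hj hl
      rcases key with ⟨k1, k2, k3⟩ | k
      · exact Or.inr (Or.inr ⟨by linarith, by linarith, by linarith⟩)
      · exact Or.inr (Or.inl ⟨k, by linarith, by linarith, by linarith⟩)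
    · have x1 := L.X_succ_right hi hj' hl
      have y1 := L.Y_succ_right hi hj hI
      have x2 := L.X_succ_left hi hj' hl
      have y2 := L.Y_succ_left hi' hj' hI'
      rcases key with ⟨k1, k2, k3⟩ | k
      · exact Or.inr (Or.inr ⟨by linarith, by linarith, by linarith⟩)
      · exact Or.inr (Or.inl ⟨k, by linarith, by linarith, by linarith⟩)
  · have hp : L.p = i + 1 := by omega
    have hq : L.q = j + 1 := by
      have h1 := L.A_p
      rw [hp, h] at h1
      exact (L.B_strictMono.injective h1).symm
    rcases hs with hs | ⟨rfl, rfl, hs⟩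
    · right
      rw [hp, hq]
      exact hs.1.trans (L.X_add_Y_le_N hi hj hI)
    · exact Or.inl ⟨hp, hq⟩

/-- The end of a run of intervals of the second tiling inside one long interval of the first. -/
theorem bounded_of_run_end (ih : BoundedBelow w r n) {i j : ℕ} (hi : i < L.p) (hj : j < L.q)
    (hI : L.inc i j) (hn : (L.p - i) + (L.q - j) < n) (h1 : L.B j < L.A (i + 1))
    (h2 : L.A (i + 1) ≤ L.B (j + 1)) (hβ : 2 / 3 ≤ L.β j) (hs : L.Good w r i j) :
    L.Bounded w := by
  rcases h2.eq_or_lt with h | h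
  · exact L.bounded_of_tie ih hi hj hI (by omega) h (Or.inl hs)
  · exact (ih L i j hi hj hI hn).2.1 h1 h hβ hs

theorem inv_bounds_of_le {x k : ℝ} (hx : 0 < x) (hx' : x ≤ 1 / 3) (h : k * (1 / (1 - x)) < 1 / x) :
    k < 1 / x - 1 := by
  have h1 : 0 < 1 - x := by linarith
  rw [mul_one_div, div_lt_div_iff₀ h1 hx] at h
  rw [lt_sub_iff_add_lt, lt_div_iff₀ hx]
  linarith

theorem le_inv_bounds_of_le {x k : ℝ} (hx : 0 < x) (hx' : x ≤ 1 / 3)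
    (h : 1 / x ≤ k * (1 / (1 - x))) : 1 / x - 1 ≤ k := by
  have h1 : 0 < 1 - x := by linarith
  rw [mul_one_div, div_le_div_iff₀ hx h1] at h
  rw [sub_le_iff_le_add, div_le_iff₀ hx]
  linarith

theorem lt_inv_bounds_of_lt {x k : ℝ} (hx : 0 < x) (hx' : x ≤ 1 / 3)
    (h : 1 / x < k * (1 / (1 - x))) : 1 / x - 1 < k := by
  have h1 : 0 < 1 - x := by linarith
  rw [mul_one_div, div_lt_div_iff₀ hx h1] at h
  rw [sub_lt_iff_lt_add, div_lt_iff₀ hx]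
  linarith

/-- The interval of the centre i has length at least 3, its leaves have length 1 / (1 - α i) ≤ 3/2.
The first leaf opens together with the centre and k more follow, so `Weight.star` applies with k + 1
leaves. -/
theorem bounded_of_star (hw : Weight w r) (ih : BoundedBelow w r n) {i j : ℕ} (hi : i < L.p)
    (hj : j < L.q) (hn : (L.p - i) + (L.q - j) < n + 1) (h : L.A i = L.B j)
    (hα : L.α i ≤ 1 / 3) (hs : L.Opened w r i j) : L.Bounded w := by
  obtain ⟨k, g1, g2, g3, g4, g5, g6, g7, g8, g9, g10⟩ := L.exists_run w hi (L.q - j) j le_rfl hj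
    (h ▸ L.B_lt_succ _) (h ▸ L.A_lt_succ _)
  have hα0 := L.α_pos i
  have hb0 : L.β j = 1 - L.α i := by
    linarith [(L.overlap' hi hj (h ▸ L.B_lt_succ _) (h ▸ L.A_lt_succ _)).2]
  have b1 : (k : ℝ) < 1 / L.α i - 1 := by
    apply inv_bounds_of_le hα0 hα
    rw [g6, A_succ, h] at g3; linarith
  have b2 : 1 / L.α i - 1 ≤ (k : ℝ) + 1 := by
    apply le_inv_bounds_of_le hα0 hα
    rw [g7, A_succ, h] at g4; linarith
  have b3 : 3 ≤ 1 / L.α i := by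
    rw [le_div_iff₀ hα0]; linarith
  have hk : (1 : ℝ) ≤ k := by linarith
  have hk' : 1 ≤ k := by exact_mod_cast hk
  obtain ⟨s1, s2, s3⟩ := hw.star (L.α i) (k + 1) hα0 hα (by push_cast; linarith)
    (by push_cast; linarith)
  push_cast at s1 s2 s3
  have hR : L.R w (i + 1) (j + k + 1) =
      L.R w i j * (w (L.α i) * w (1 - L.α i) ^ (k + 1)) := by
    rw [g8, R_succ_right, R_succ_left, hb0, pow_succ]; ring
  have hR0 := L.R_pos hw i j
  refine L.bounded_of_run_end ih hi g1 g2 (by omega) g3 g4 (by linarith) ?_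
  set G := w (L.α i) * w (1 - L.α i) ^ (k + 1) with hG
  have m1 : L.R w i j * G ≤ L.R w i j * (k + 1 + 1) := mul_le_mul_of_nonneg_left s1 hR0.le
  have m2 : L.R w i j * (r ^ 2 * G) ≤ L.R w i j * (2 * (k + 1) + 3) :=
    mul_le_mul_of_nonneg_left s2 hR0.le
  -- Common to an empty prefix (a = 1) and to the third state of `Opened` (a = R).
  have main : ∀ a : ℝ, L.R w i j ≤ a → a ≤ L.X i j → a ≤ L.Y i j → L.Good w r i (j + k) := by
    intro a h0 h1 h2
    have h3 : (k : ℝ) * a ≤ k * L.X i j := mul_le_mul_of_nonneg_left h1 (by linarith)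
    have h4 : (k : ℝ) * L.R w i j ≤ k * a := mul_le_mul_of_nonneg_left h0 (by linarith)
    have h5 : 1 * L.R w i j ≤ k * L.R w i j := mul_le_mul_of_nonneg_right hk hR0.le
    refine ⟨?_, ?_, ?_⟩ <;> rw [hR] <;> linarith
  rcases hs with ⟨h1, rfl, rfl⟩ | ⟨h1, h2, h3, h4⟩ | ⟨h1, h2, h3⟩
  · exact main 1 h1.le (L.one_le_X _ _) (L.one_le_Y _ _)
  -- After a lone pair the prefix weight is r ^ 2; this is the case that needs the factor r ^ 4 in
  -- `Weight.star`.
  · have t1 : (k : ℝ) * 2 ≤ k * L.X i j := mul_le_mul_of_nonneg_left h2 (by linarith)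
    refine ⟨?_, ?_, ?_⟩ <;> rw [hR, h1] <;> linarith
  · exact main _ le_rfl h1 h2

/-- The last leaf j overhangs its centre, and β j ≥ 2/3 makes the next element i + 1 a centre too.
The leaf j is shared and already counted in R, so only the k later leaves enter `Weight.star`. -/
theorem bounded_of_inner_star (hw : Weight w r) (ih : BoundedBelow w r n) {i j : ℕ} (hi : i < L.p)
    (hj : j < L.q) (hI : L.inc i j) (hn : (L.p - i) + (L.q - j) < n + 1)
    (h1 : L.B j < L.A (i + 1)) (h2 : L.A (i + 1) < L.B (j + 1)) (hβ : 2 / 3 ≤ L.β j)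
    (hs : L.Good w r i j) : L.Bounded w := by
  have hi' : i + 1 < L.p := L.lt_p_of_A_lt hj h2
  obtain ⟨hI', hsum⟩ := L.overlap' hi' hj h2 (h1.trans (L.A_lt_succ _))
  have hα0 := L.α_pos (i + 1)
  have hα : L.α (i + 1) ≤ 1 / 3 := by linarith
  have hb0 : L.β j = 1 - L.α (i + 1) := by linarith
  obtain ⟨k, g1, g2, g3, g4, g5, g6, g7, g8, g9, g10⟩ := L.exists_run w hi' (L.q - j) j le_rfl hj
    h2 (h1.trans (L.A_lt_succ _))
  rw [L.A_succ (i + 1)] at g3 g4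
  rw [B_succ, hb0] at h2
  have b1 : (k : ℝ) - 1 < 1 / L.α (i + 1) - 1 := by
    apply inv_bounds_of_le hα0 hα
    rw [g6] at g3; linarith
  have b2 : 1 / L.α (i + 1) - 1 < (k : ℝ) + 1 := by
    apply lt_inv_bounds_of_lt hα0 hα
    rw [g7] at g4; linarith
  have b3 : 3 ≤ 1 / L.α (i + 1) := by
    rw [le_div_iff₀ hα0]; linarith
  have hk : (1 : ℝ) ≤ k := by linarith
  obtain ⟨s1, s2, -⟩ := hw.star (L.α (i + 1)) k hα0 hα (by linarith) (by linarith)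
  rw [← L.A_succ (i + 1)] at g3 g4
  refine L.bounded_of_run_end ih hi' g1 g2 (by omega) g3 g4 (by linarith) ?_
  have x1 := L.X_succ_left hi hj hI
  have hR : L.R w (i + 1 + 1) (j + k + 1) =
      L.R w (i + 1) (j + 1) * (w (L.α (i + 1)) * w (1 - L.α (i + 1)) ^ k) := by
    rw [g8, R_succ_left]; ring
  have hR0 := L.R_pos hw (i + 1) (j + 1)
  have hY := L.one_le_Y (i + 1) j
  set G := w (L.α (i + 1)) * w (1 - L.α (i + 1)) ^ k with hG
  set R0 := L.R w (i + 1) (j + 1)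
  have m1 : R0 * G ≤ R0 * (k + 1) := mul_le_mul_of_nonneg_left s1 hR0.le
  have m2 : R0 * (r ^ 2 * G) ≤ R0 * (2 * k + 3) := mul_le_mul_of_nonneg_left s2 hR0.le
  have h0 : R0 ≤ L.X (i + 1) j := hs.1.trans x1
  have h4 : (k : ℝ) * R0 ≤ k * L.X (i + 1) j := mul_le_mul_of_nonneg_left h0 (by linarith)
  have h5 : 1 * R0 ≤ k * R0 := mul_le_mul_of_nonneg_right hk hR0.le
  refine ⟨?_, ?_, ?_⟩ <;> rw [hR] <;> linarith

/-- All entries lie in (1/3, 2/3), so each new element multiplies R by r. One or two short intervals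
start inside the long one, and the invariants R ≤ 2X and R ≤ X + Y persist until the next common
endpoint. -/
theorem bounded_of_alternating (hw : Weight w r) (ih : BoundedBelow w r n) {i j : ℕ} (hi : i < L.p)
    (hj : j < L.q) (hI : L.inc i j) (hn : (L.p - i) + (L.q - j) < n + 1) (h1 : L.B j < L.A i)
    (h2 : L.A i < L.B (j + 1)) (hα : 1 / 3 < L.α i) (hα' : L.α i < 1 / 2)
    (hXY : L.R w (i + 1) (j + 1) ≤ 2 * L.X i j) (hs : L.R w (i + 1) (j + 1) ≤ L.X i j + L.Y i j) :
    L.Bounded w := by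
  have hb0 : L.β j = 1 - L.α i := by
    linarith [(L.overlap' hi hj h2 (h1.trans (L.A_lt_succ _))).2]
  have len1 : 1 / (1 - L.α i) < 1 / L.α i :=
    one_div_lt_one_div_of_lt (by linarith) (by linarith)
  have len2 : 1 / L.α i < 2 * (1 / (1 - L.α i)) := by
    rw [mul_one_div, div_lt_div_iff₀ (by linarith) (by linarith)]; linarith
  have c1 : L.B (j + 1) < L.A (i + 1) := by rw [B_succ, A_succ, hb0]; linarith
  have hj1 : j + 1 < L.q := L.lt_q_of_B_lt hi c1
  obtain ⟨hI1, hs1⟩ := L.overlap' hi hj1 (h2.trans (L.B_lt_succ _)) c1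
  have hb1 : L.β (j + 1) = 1 - L.α i := by linarith
  have x1 := L.X_succ_right hi hj1 hI1
  have y1 := L.Y_succ_right hi hj hI
  have hX := L.one_le_X i j
  have hY := L.one_le_Y i j
  have r1 := hw.le
  have r2 := hw.sq_le
  have r3 := hw.cube_le
  have r4 := hw.r_pos
  have hR0 := L.R_pos hw (i + 1) (j + 1)
  have w1 : w (1 - L.α i) = r := hw.half _ (by linarith) (by linarith)
  have w2 : w (L.α i) = r := hw.half _ (by linarith) (by linarith)
  have hR1 : L.R w (i + 1) (j + 1 + 1) = L.R w (i + 1) (j + 1) * r := by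
    rw [R_succ_right, hb1, w1]
  set R0 := L.R w (i + 1) (j + 1)
  have m1 : R0 * r ≤ R0 * (1496 / 1000) := mul_le_mul_of_nonneg_left r1 hR0.le
  have m2 : R0 * r ^ 2 ≤ R0 * (2237 / 1000) := mul_le_mul_of_nonneg_left r2 hR0.le
  have m3 : R0 * r ^ 3 ≤ R0 * (34 / 10) := mul_le_mul_of_nonneg_left r3 hR0.le
  -- The three cases multiply R by r ^ 3, r and r ^ 2.
  rcases lt_trichotomy (L.B (j + 1 + 1)) (L.A (i + 1)) with c2 | c2 | c2
  · have hj2 : j + 1 + 1 < L.q := L.lt_q_of_B_lt hi c2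
    obtain ⟨hI2, hs2⟩ := L.overlap' hi hj2
      ((h2.trans (L.B_lt_succ _)).trans (L.B_lt_succ _)) c2
    have hb2 : L.β (j + 1 + 1) = 1 - L.α i := by linarith
    have c3 : L.A (i + 1) < L.B (j + 1 + 1 + 1) := by
      rw [B_succ, B_succ, A_succ, hb2, hb1]; linarith
    have hi1 : i + 1 < L.p := L.lt_p_of_A_lt hj2 c3
    obtain ⟨hI3, hs3⟩ := L.overlap' hi1 hj2 c3 (c2.trans (L.A_lt_succ _))
    have hb3 : L.α (i + 1) = L.α i := by linarith
    have x2 := L.X_succ_right hi hj2 hI2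
    have y2 := L.Y_succ_right hi hj1 hI1
    have x3 := L.X_succ_left hi hj2 hI2
    have y3 := L.Y_succ_left hi1 hj2 hI3
    refine (ih L (i + 1) (j + 1 + 1) hi1 hj2 hI3 (by omega)).2.2 c2 c3 (by linarith) (by linarith)
      ?_ ?_ <;> rw [R_succ_left, R_succ_right, hR1, hb2, hb3, w1, w2] <;> linarith
  · refine L.bounded_of_tie ih hi hj1 hI1 (by omega) c2.symm (Or.inl ⟨?_, ?_, ?_⟩) <;>
      rw [hR1] <;> linarith
  · have hi1 : i + 1 < L.p := L.lt_p_of_A_lt hj1 c2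
    obtain ⟨hI3, hs3⟩ := L.overlap' hi1 hj1 c2 (c1.trans (L.A_lt_succ _))
    have hb3 : L.α (i + 1) = L.α i := by linarith
    have x3 := L.X_succ_left hi hj1 hI1
    have y3 := L.Y_succ_left hi1 hj1 hI3
    refine (ih L (i + 1) (j + 1) hi1 hj1 hI3 (by omega)).2.2 c1 c2 (by linarith) (by linarith)
      ?_ ?_ <;> rw [R_succ_left, hR1, hb3, w2] <;> linarith

theorem bounded_of_opened_half (hw : Weight w r) (ih : BoundedBelow w r n) {i j : ℕ} (hi : i < L.p)
    (hj : j < L.q) (hI : L.inc i j) (hn : (L.p - i) + (L.q - j) < n + 1) (h : L.A i = L.B j)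
    (hα : 1 / 3 < L.α i) (hα' : L.α i ≤ 1 / 2) (hs : L.Opened w r i j) : L.Bounded w := by
  have hb0 : L.β j = 1 - L.α i := by
    linarith [(L.overlap' hi hj (h ▸ L.B_lt_succ _) (h ▸ L.A_lt_succ _)).2]
  have r2 := hw.sq_le
  have r2' := hw.two_le
  have r4 := hw.le_five
  have r0 := hw.r_pos
  have hX := L.one_le_X i j
  have hY := L.one_le_Y i j
  have hR0 := L.R_pos hw i j
  have w1 : w (1 - L.α i) = r := hw.half _ (by linarith) (by linarith)
  have w2 : w (L.α i) = r := hw.half _ (by linarith) (by linarith)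
  have hR : L.R w (i + 1) (j + 1) = L.R w i j * r ^ 2 := by
    rw [R_succ_right, R_succ_left, hb0, w1, w2]; ring
  have r6 : r ^ 6 ≤ 12 := by
    have : r ^ 6 = r ^ 4 * r ^ 2 := by ring
    rw [this]; nlinarith
  have m1 : L.R w i j * r ^ 4 ≤ L.R w i j * 5 := mul_le_mul_of_nonneg_left r4 hR0.le
  have m2 : L.R w i j * 2 ≤ L.R w i j * r ^ 2 := mul_le_mul_of_nonneg_left r2' hR0.le
  have key : L.R w i j * r ^ 4 ≤ 3 * L.X i j + 2 * L.Y i j ∧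
      L.R w i j * r ^ 4 ≤ 2 * L.X i j + 3 * L.Y i j := by
    rcases hs with ⟨h1, -, -⟩ | ⟨h1, h2, h3, h4⟩ | ⟨h1, h2, h3⟩
    · rw [h1] at m1 ⊢; constructor <;> linarith
    · rw [h1]; constructor <;> linarith
    · constructor <;> linarith
  rcases hα'.eq_or_lt with h2 | h2
  · refine L.bounded_of_tie ih hi hj hI hn (by rw [A_succ, B_succ, h, hb0, h2]; norm_num) ?_
    rcases hs with ⟨h1, rfl, rfl⟩ | ⟨h1, h2, h3, h4⟩ | ⟨h1, h2, h3⟩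
    · right
      exact ⟨rfl, rfl, by rw [hR, h1, one_mul]⟩
    · left
      refine ⟨?_, ?_, ?_⟩ <;> rw [hR]
      · rw [h1]; linarith
      · linarith [key.1]
      · linarith [key.2]
    · left
      refine ⟨?_, ?_, ?_⟩ <;> rw [hR]
      · linarith
      · linarith [key.1]
      · linarith [key.2]
  · have len1 : 1 / (1 - L.α i) < 1 / L.α i :=
      one_div_lt_one_div_of_lt (by linarith) (by linarith)
    have len2 : 1 / L.α i < 2 * (1 / (1 - L.α i)) := by
      rw [mul_one_div, div_lt_div_iff₀ (by linarith) (by linarith)]; linarith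
    have c1 : L.B (j + 1) < L.A (i + 1) := by rw [B_succ, A_succ, hb0, h]; linarith
    have hj1 : j + 1 < L.q := L.lt_q_of_B_lt hi c1
    obtain ⟨hI1, hs1⟩ := L.overlap' hi hj1 (h ▸ (L.B_lt_succ _).trans (L.B_lt_succ _)) c1
    have hb1 : L.β (j + 1) = 1 - L.α i := by linarith
    have c2 : L.A (i + 1) < L.B (j + 1 + 1) := by
      rw [B_succ, B_succ, A_succ, hb0, hb1, h]; linarith
    have hi1 : i + 1 < L.p := L.lt_p_of_A_lt hj1 c2
    obtain ⟨hI3, hs3⟩ := L.overlap' hi1 hj1 c2 (c1.trans (L.A_lt_succ _))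
    have hb3 : L.α (i + 1) = L.α i := by linarith
    have x1 := L.X_succ_right hi hj1 hI1
    have y1 := L.Y_succ_right hi hj hI
    have x3 := L.X_succ_left hi hj1 hI1
    have y3 := L.Y_succ_left hi1 hj1 hI3
    refine (ih L (i + 1) (j + 1) hi1 hj1 hI3 (by omega)).2.2 c1 c2 (by linarith) (by linarith)
      ?_ ?_ <;> rw [R_succ_left, R_succ_right, hR, hb3, hb1, w1, w2] <;> linarith [key.1]

/-- Exchanging the chains is needed only at a common endpoint, to make the first of two entries with
sum 1 the smaller one. The other two states already fix which chain carries the small entries. -/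
theorem boundedBelow (hw : Weight w r) (n : ℕ) : BoundedBelow w r n := by
  induction n with
  | zero => intro L i j _ _ _ h; omega
  | succ n ih =>
    intro L i j hi hj hI hn
    refine ⟨fun h hs => ?_, fun h1 h2 hβ hs => L.bounded_of_inner_star hw ih hi hj hI hn h1 h2 hβ hs,
      fun h1 h2 h3 h4 h5 h6 => L.bounded_of_alternating hw ih hi hj hI hn h1 h2 h3 h4 h5 h6⟩
    have hsum := (L.overlap' hi hj (h ▸ L.B_lt_succ _) (h ▸ L.A_lt_succ _)).2
    rcases le_or_gt (L.α i) (1 / 2) with h1 | h1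
    · rcases le_or_gt (L.α i) (1 / 3) with h2 | h2
      · exact L.bounded_of_star hw ih hi hj hn h h2 hs
      · exact L.bounded_of_opened_half hw ih hi hj hI hn h h2 h1 hs
    · have hn' : (L.swap.p - j) + (L.swap.q - i) < n + 1 := by
        change (L.q - j) + (L.p - i) < n + 1; omega
      apply Bounded.of_swap
      rcases le_or_gt (L.β j) (1 / 3) with h2 | h2
      · exact L.swap.bounded_of_star hw ih hj hi hn' h.symm h2 (Opened.swap L hs)
      · exact L.swap.bounded_of_opened_half hw ih hj hi hI hn' h.symm h2
          (show L.β j ≤ 1 / 2 by linarith) (Opened.swap L hs)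

theorem bounded (hw : Weight w r) : L.Bounded w := by
  have hA : L.A 0 = 0 := rfl
  have hB : L.B 0 = 0 := rfl
  have hI := (L.overlap' L.p_pos L.q_pos (by rw [hA, ← hB]; exact L.B_lt_succ 0)
    (by rw [hB, ← hA]; exact L.A_lt_succ 0)).1
  refine (boundedBelow hw _ L 0 0 L.p_pos L.q_pos hI (Nat.lt_succ_self _)).1 rfl
    (Or.inl ⟨by simp [R], rfl, rfl⟩)

end Layout

end PosetEntropy

/-! ### Rounding of the entries and numerical bounds for ε -/

namespace PosetEntropy

open Real

/-- A monotone rounding of `(0, 1)` that is compatible with `x ↦ 1 - x`. -/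
noncomputable def rounding (x : ℝ) : ℝ :=
  if x ≤ 1 / 3 then 1 / (⌊1 / x⌋₊ : ℝ) else
    if x < 2 / 3 then 1 / 2 else 1 - 1 / (⌊1 / (1 - x)⌋₊ : ℝ)

theorem three_le_floor {x : ℝ} (hx : 0 < x) (h : x ≤ 1 / 3) : 3 ≤ ⌊1 / x⌋₊ := by
  apply Nat.le_floor
  rw [le_div_iff₀ hx]; push_cast; linarith

theorem rounding_of_le {x : ℝ} (h : x ≤ 1 / 3) : rounding x = 1 / (⌊1 / x⌋₊ : ℝ) := if_pos h

theorem rounding_of_lt {x : ℝ} (h : 1 / 3 < x) (h' : x < 2 / 3) : rounding x = 1 / 2 := by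
  rw [rounding, if_neg h.not_ge, if_pos h']

theorem rounding_of_ge {x : ℝ} (h : 2 / 3 ≤ x) : rounding x = 1 - 1 / (⌊1 / (1 - x)⌋₊ : ℝ) := by
  rw [rounding, if_neg (by linarith), if_neg h.not_gt]

theorem rounding_add_rounding_one_sub (x : ℝ) : rounding x + rounding (1 - x) = 1 := by
  rcases le_or_gt x (1 / 3) with h | h
  · rw [rounding_of_le h, rounding_of_ge (by linarith), sub_sub_cancel]; ring
  · rcases lt_or_ge x (2 / 3) with h' | h'
    · rw [rounding_of_lt h h', rounding_of_lt (by linarith) (by linarith)]; norm_num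
    · rw [rounding_of_ge h', rounding_of_le (x := 1 - x) (by linarith)]; ring

theorem rounding_le_third {x : ℝ} (hx : 0 < x) (h : x ≤ 1 / 3) :
    0 < rounding x ∧ rounding x ≤ 1 / 3 := by
  have h3 : (3 : ℝ) ≤ ⌊1 / x⌋₊ := by exact_mod_cast three_le_floor hx h
  rw [rounding_of_le h]
  exact ⟨by positivity, one_div_le_one_div_of_le (by norm_num) h3⟩

theorem third_le_rounding {x : ℝ} (hx : x < 1) (h : 2 / 3 ≤ x) :
    2 / 3 ≤ rounding x ∧ rounding x < 1 := by
  have h1 := rounding_le_third (x := 1 - x) (by linarith) (by linarith)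
  have h2 := rounding_add_rounding_one_sub x
  exact ⟨by linarith, by linarith⟩

theorem rounding_pos {x : ℝ} (hx : 0 < x) (hx' : x < 1) : 0 < rounding x := by
  rcases le_or_gt x (1 / 3) with h | h
  · exact (rounding_le_third hx h).1
  · rcases lt_or_ge x (2 / 3) with h' | h'
    · rw [rounding_of_lt h h']; norm_num
    · linarith [(third_le_rounding hx' h').1]

theorem rounding_mono_of_le {x y : ℝ} (hx : 0 < x) (hxy : x ≤ y) (h : y ≤ 1 / 3) :
    rounding x ≤ rounding y := by
  have hy : 0 < y := hx.trans_le hxy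
  have h3 : 3 ≤ ⌊1 / y⌋₊ := three_le_floor hy h
  rw [rounding_of_le (hxy.trans h), rounding_of_le h]
  apply one_div_le_one_div_of_le
  · have : 0 < ⌊1 / y⌋₊ := by omega
    exact_mod_cast this
  · exact_mod_cast Nat.floor_mono (one_div_le_one_div_of_le hx hxy)

theorem rounding_mono {x y : ℝ} (hx : 0 < x) (hy : y < 1) (hxy : x ≤ y) :
    rounding x ≤ rounding y := by
  rcases le_or_gt y (1 / 3) with h | h
  · exact rounding_mono_of_le hx hxy h
  · rcases le_or_gt (2 / 3) x with h' | h'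
    · have := rounding_mono_of_le (x := 1 - y) (y := 1 - x) (by linarith) (by linarith)
        (by linarith)
      have h1 := rounding_add_rounding_one_sub x
      have h2 := rounding_add_rounding_one_sub y
      linarith
    · have h1 : rounding x ≤ 1 / 2 := by
        rcases le_or_gt x (1 / 3) with g | g
        · linarith [(rounding_le_third hx g).2]
        · exact (rounding_of_lt g h').le
      have h2 : 1 / 2 ≤ rounding y := by
        rcases le_or_gt (2 / 3) y with g | g
        · linarith [(third_le_rounding hy g).1]
        · exact (rounding_of_lt h g).ge
      linarith

/-- From y ≤ 1 - x, by monotonicity and the symmetry of the rounding. Thus rounding preserves the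
edge constraints. -/
theorem rounding_add_le {x y : ℝ} (hx : 0 < x) (hy : 0 < y) (h : x + y ≤ 1) :
    rounding x + rounding y ≤ 1 := by
  have h1 := rounding_mono (x := y) (y := 1 - x) hy (by linarith) (by linarith)
  linarith [rounding_add_rounding_one_sub x]

/-- From 2 ^ 19 ≤ 3 ^ 12. The next three bounds come from 3 ^ 17 ≤ 2 ^ 27, 2 ^ 37 ≤ 5 ^ 16 and 2 ^
14 ≤ 7 ^ 5. -/
theorem logb_two_three_ge : 19 / 12 ≤ logb 2 3 := by
  rw [le_logb_iff_rpow_le (by norm_num) (by norm_num)]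
  have h : ((2 : ℝ) ^ (19 / 12 : ℝ)) ^ (12 : ℕ) ≤ 3 ^ 12 := by
    rw [← rpow_natCast, ← rpow_mul (by norm_num)]; norm_num
  exact le_of_pow_le_pow_left₀ (by norm_num) (by norm_num) h

theorem logb_two_three_le : logb 2 3 ≤ 27 / 17 := by
  rw [logb_le_iff_le_rpow (by norm_num) (by norm_num)]
  have h : (3 : ℝ) ^ 17 ≤ ((2 : ℝ) ^ (27 / 17 : ℝ)) ^ (17 : ℕ) := by
    rw [← rpow_natCast ((2 : ℝ) ^ (27 / 17 : ℝ)), ← rpow_mul (by norm_num)]; norm_num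
  exact le_of_pow_le_pow_left₀ (by norm_num) (by positivity) h

theorem logb_two_five_ge : 37 / 16 ≤ logb 2 5 := by
  rw [le_logb_iff_rpow_le (by norm_num) (by norm_num)]
  have h : ((2 : ℝ) ^ (37 / 16 : ℝ)) ^ (16 : ℕ) ≤ 5 ^ 16 := by
    rw [← rpow_natCast, ← rpow_mul (by norm_num)]; norm_num
  exact le_of_pow_le_pow_left₀ (by norm_num) (by norm_num) h

theorem logb_two_seven_ge : 14 / 5 ≤ logb 2 7 := by
  rw [le_logb_iff_rpow_le (by norm_num) (by norm_num)]
  have h : ((2 : ℝ) ^ (14 / 5 : ℝ)) ^ (5 : ℕ) ≤ 7 ^ 5 := by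
    rw [← rpow_natCast, ← rpow_mul (by norm_num)]; norm_num
  exact le_of_pow_le_pow_left₀ (by norm_num) (by norm_num) h

/-- The equation behind the choice of ε: the star with two leaves, with its three linear extensions,
is an equality case. -/
theorem two_sub_eps_mul : (2 - eps) * logb 2 3 = 3 * logb 2 3 - 2 := by
  have h : logb 2 3 ≠ 0 := by linarith [logb_two_three_ge]
  rw [eps]; field_simp; ring

theorem two_sub_eps_ge : 33 / 19 ≤ 2 - eps := by
  have h1 := two_sub_eps_mul
  have h2 := logb_two_three_ge
  by_contra h
  push Not at h
  nlinarith

theorem two_sub_eps_lt : 2 - eps < 2 := by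
  have h1 := two_sub_eps_mul
  have h2 := logb_two_three_ge
  have h3 := logb_two_three_le
  by_contra h
  push Not at h
  nlinarith

theorem abs_eps_sub_lt : |eps - 0.26| < 0.005 := by
  have h1 := two_sub_eps_mul
  have h2 := logb_two_three_ge
  have h3 := logb_two_three_le
  rw [abs_lt]
  constructor
  · by_contra h
    push Not at h
    norm_num at h
    nlinarith
  · by_contra h
    push Not at h
    norm_num at h
    nlinarith

/-! ### Costs of stars -/

/-- The cost of a star with `m` leaves for the vector with entries `1 / (q + 1)` at the centre and
`q / (q + 1)` at the leaves. -/
noncomputable def starCost (q m : ℕ) : ℝ :=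
  logb 2 (q + 1) + m * (logb 2 (q + 1) - logb 2 q)

/-- A star cost is dominated by the logarithms of the relevant numbers of linear extensions. -/
def StarBound (z : ℝ) (m : ℕ) : Prop :=
  z ≤ (2 - eps) * logb 2 (m + 1) ∧ z + 2 ≤ (2 - eps) * logb 2 (2 * m + 3) ∧
    z + 4 ≤ (2 - eps) * logb 2 (4 * m + 8)

/-- The first difference of the logarithm at m is at most 1 / m, and minus its second difference is
at least 1 / m ^ 2. Consequently `starCost (m - 1) m` grows by at most log ((m + 1) / m) when m
grows by 1. -/
theorem mul_logb_step {m : ℝ} (hm : 1 < m) :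
    (m + 1) * (logb 2 (m + 1) - logb 2 m) ≤ m * (logb 2 m - logb 2 (m - 1)) := by
  have h0 : 0 < m - 1 := by linarith
  have h1 : log (m + 1) - log m ≤ 1 / m := by
    rw [← log_div (by linarith) (by linarith)]
    refine (log_le_sub_one_of_pos (by positivity)).trans (le_of_eq ?_)
    field_simp; ring
  have h2 : 1 / m ^ 2 ≤ 2 * log m - log (m - 1) - log (m + 1) := by
    have e : 2 * log m - log (m - 1) - log (m + 1) = log (m ^ 2 / ((m - 1) * (m + 1))) := by
      rw [log_div (by positivity) (by positivity), log_mul (by positivity) (by positivity), log_pow]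
      push_cast; ring
    rw [e]
    refine le_trans (le_of_eq ?_) (one_sub_inv_le_log_of_pos (by positivity))
    field_simp; ring
  have h3 : 1 / m ≤ m * (2 * log m - log (m - 1) - log (m + 1)) := by
    calc 1 / m = m * (1 / m ^ 2) := by field_simp
      _ ≤ _ := mul_le_mul_of_nonneg_left h2 (by linarith)
  have h4 : (m + 1) * (log (m + 1) - log m) ≤ m * (log m - log (m - 1)) := by nlinarith
  have h5 : 0 < log 2 := log_pos (by norm_num)
  simp only [logb, ← sub_div, ← mul_div_assoc]
  gcongr

/-- Bernoulli's inequality: (s / t) ^ (2 - ε) ≥ 1 + (2 - ε) (s - t) / t ≥ 1 + 1 / m. -/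
theorem logb_step {m s t : ℝ} (hm : 0 < m) (ht : 0 < t) (hs : t < s)
    (h : t ≤ (2 - eps) * m * (s - t)) :
    logb 2 (m + 1) - logb 2 m ≤ (2 - eps) * (logb 2 s - logb 2 t) := by
  have hc := two_sub_eps_ge
  have hs0 : 0 < s := ht.trans hs
  rw [← logb_div (by linarith) (by linarith), ← logb_div (by linarith) (by linarith),
    ← logb_rpow_eq_mul_logb_of_pos (by positivity)]
  apply logb_le_logb_of_le (by norm_num) (by positivity)
  have h1 := one_add_mul_self_le_rpow_one_add (s := (s - t) / t) (p := 2 - eps)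
    (by have : 0 ≤ (s - t) / t := div_nonneg (by linarith) ht.le
        linarith) (by linarith)
  have e : 1 + (s - t) / t = s / t := by field_simp; ring
  rw [e] at h1
  refine le_trans ?_ h1
  rw [add_div, div_self hm.ne']
  gcongr 1 + ?_
  rw [div_le_iff₀ hm, ← mul_div_assoc, div_mul_eq_mul_div, le_div_iff₀ ht]
  linarith

theorem logb_two_pow (n : ℕ) : logb 2 ((2 : ℝ) ^ n) = n := by
  rw [logb_pow]; simp

theorem logb_two_four : logb 2 4 = 2 := by
  have := logb_two_pow 2; norm_num at this; exact this

theorem starBound_two_three : StarBound (starCost 2 3) 3 := by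
  have h1 := logb_two_three_ge
  have h2 := logb_two_three_le
  have h3 := logb_two_five_ge
  have hc := two_sub_eps_ge
  have e9 : logb 2 9 = 2 * logb 2 3 := by
    rw [show (9 : ℝ) = 3 ^ 2 by norm_num, logb_pow]; norm_num
  have e20 : logb 2 20 = 2 + logb 2 5 := by
    rw [show (20 : ℝ) = 4 * 5 by norm_num, logb_mul (by norm_num) (by norm_num), logb_two_four]
  have e2 : logb 2 2 = 1 := logb_self_eq_one (by norm_num)
  have hv : starCost 2 3 = 4 * logb 2 3 - 3 := by
    rw [starCost]; norm_num; ring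
  have hm := two_sub_eps_mul
  unfold StarBound
  rw [hv]
  norm_num
  rw [e9, e20, logb_two_four]
  refine ⟨by linarith, by linarith, by nlinarith⟩

theorem starBound_two_two : StarBound (starCost 2 2) 2 := by
  have h1 := logb_two_three_ge
  have h2 := logb_two_three_le
  have h3 := logb_two_seven_ge
  have hc := two_sub_eps_ge
  have hm := two_sub_eps_mul
  have e16 : logb 2 16 = 4 := by
    have := logb_two_pow 4; norm_num at this; exact this
  have hv : starCost 2 2 = 3 * logb 2 3 - 2 := by
    rw [starCost]; norm_num; ring
  unfold StarBound
  rw [hv]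
  norm_num
  rw [e16]
  -- The first bound is an equality, by `two_sub_eps_mul`.
  refine ⟨by linarith, by nlinarith, by linarith⟩

/-- One more leaf raises the cost by at most log ((m + 1) / m) with m = k + 3, and by `logb_step`
each of the three right-hand sides rises by at least as much. -/
theorem starBound_succ (k : ℕ) : StarBound (starCost (k + 2) (k + 3)) (k + 3) := by
  induction k with
  | zero => exact starBound_two_three
  | succ k ih =>
    obtain ⟨h1, h2, h3⟩ := ih
    have hk : (0 : ℝ) ≤ k := Nat.cast_nonneg k
    have hc := two_sub_eps_ge
    have s0 := mul_logb_step (m := (k : ℝ) + 3) (by linarith)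
    have s1 := logb_step (m := (k : ℝ) + 3) (t := k + 4) (s := k + 5) (by linarith) (by linarith)
      (by linarith) (by nlinarith)
    have s2 := logb_step (m := (k : ℝ) + 3) (t := 2 * k + 9) (s := 2 * k + 11) (by linarith)
      (by linarith) (by linarith) (by nlinarith)
    have s3 := logb_step (m := (k : ℝ) + 3) (t := 4 * k + 20) (s := 4 * k + 24) (by linarith)
      (by linarith) (by linarith) (by nlinarith)
    unfold StarBound
    unfold starCost at h1 h2 h3 ⊢
    push_cast at h1 h2 h3 ⊢
    ring_nf at h1 h2 h3 s0 s1 s2 s3 ⊢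
    refine ⟨by linarith, by linarith, by linarith⟩

theorem starBound {q m : ℕ} (hq : 2 ≤ q) (hm : m = q ∨ m = q + 1) : StarBound (starCost q m) m := by
  obtain ⟨k, rfl⟩ := Nat.exists_eq_add_of_le' hq
  rcases hm with rfl | rfl
  · rcases k with _ | k
    · exact starBound_two_two
    · obtain ⟨h1, h2, h3⟩ := starBound_succ k
      have hk : (0 : ℝ) ≤ k := Nat.cast_nonneg k
      have s0 := mul_logb_step (m := (k : ℝ) + 3) (by linarith)
      -- For the same number of leaves the larger denominator is cheaper, again by `mul_logb_step`.
      have hle : starCost (k + 1 + 2) (k + 1 + 2) ≤ starCost (k + 2) (k + 3) := by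
        unfold starCost
        push_cast
        ring_nf at s0 ⊢
        linarith
      have e : k + 1 + 2 = k + 3 := by ring
      rw [e] at hle ⊢
      exact ⟨by linarith, by linarith, by linarith⟩
  · exact starBound_succ k

/-- The weight of an element with entry `x`, normalized so that products of weights can be compared
with numbers of linear extensions. -/
noncomputable def weight (x : ℝ) : ℝ := 2 ^ (-logb 2 (rounding x) / (2 - eps))

theorem rpow_div_le {z y : ℝ} (hy : 0 < y) (h : z ≤ (2 - eps) * logb 2 y) :
    (2 : ℝ) ^ (z / (2 - eps)) ≤ y := by
  have hc := two_sub_eps_ge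
  rw [← le_logb_iff_rpow_le (by norm_num) hy, div_le_iff₀ (by linarith)]
  linarith

theorem weight_isWeight : Layout.Weight weight (2 ^ (1 / (2 - eps))) where
  pos x := by unfold weight; positivity
  half x h h' := by
    rw [weight, rounding_of_lt h h', one_div, logb_inv, logb_self_eq_one (by norm_num), neg_neg]
  two_le := by
    have h1 := two_sub_eps_ge
    have h2 := two_sub_eps_lt
    rw [← rpow_natCast, ← rpow_mul (by norm_num)]
    calc (2 : ℝ) = 2 ^ (1 : ℝ) := by simp
      _ ≤ _ := by
        apply rpow_le_rpow_of_exponent_le (by norm_num)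
        rw [div_mul_eq_mul_div, le_div_iff₀ (by linarith)]
        push_cast; linarith
  le_five := by
    have h1 := two_sub_eps_ge
    have h3 := logb_two_five_ge
    rw [← rpow_natCast, ← rpow_mul (by norm_num), div_mul_eq_mul_div]
    apply rpow_div_le (by norm_num)
    push_cast
    nlinarith
  r_pos := by positivity
  star x m hx hx' h1 h2 := by
    obtain ⟨q, hq⟩ : ∃ q, ⌊1 / x⌋₊ = q + 1 :=
      Nat.exists_eq_add_of_le' (by have := three_le_floor hx hx'; omega)
    have hq2 : 2 ≤ q := by have := three_le_floor hx hx'; omega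
    have f1 : ((q + 1 : ℕ) : ℝ) ≤ 1 / x := hq ▸ Nat.floor_le (by positivity)
    have f2 : 1 / x < ((q + 1 : ℕ) : ℝ) + 1 := hq ▸ Nat.lt_floor_add_one _
    -- Since q + 1 ≤ 1 / x < q + 2, the window (1 / x - 2, 1 / x) leaves only two numbers of leaves.
    have hm : m = q ∨ m = q + 1 := by
      have g1 : (q : ℝ) < m + 1 := by push_cast at f1; linarith
      have g2 : (m : ℝ) < q + 2 := by push_cast at f2; linarith
      have g1' : q < m + 1 := by exact_mod_cast g1
      have g2' : m < q + 2 := by exact_mod_cast g2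
      omega
    obtain ⟨b1, b2, b3⟩ := starBound hq2 hm
    have hq0 : (0 : ℝ) < q := by exact_mod_cast (by omega : 0 < q)
    have r1 : rounding x = 1 / ((q : ℝ) + 1) := by
      rw [rounding_of_le hx', hq]; push_cast; rfl
    have r2 : rounding (1 - x) = (q : ℝ) / (q + 1) := by
      have := rounding_add_rounding_one_sub x
      rw [r1] at this
      rw [eq_div_iff (by positivity)]
      field_simp at this
      linarith
    have hG : weight x * weight (1 - x) ^ m = 2 ^ (starCost q m / (2 - eps)) := by
      rw [weight, weight, r1, r2, ← rpow_natCast, ← rpow_mul (by norm_num),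
        ← rpow_add (by norm_num), one_div, logb_inv, logb_div hq0.ne' (by positivity), starCost]
      congr 1
      ring
    have hr : ∀ n : ℕ, ((2 : ℝ) ^ (1 / (2 - eps))) ^ n * (2 : ℝ) ^ (starCost q m / (2 - eps)) =
        2 ^ ((starCost q m + n) / (2 - eps)) := by
      intro n
      rw [← rpow_natCast, ← rpow_mul (by norm_num), ← rpow_add (by norm_num)]
      congr 1
      ring
    rw [hG, hr, hr]
    exact ⟨rpow_div_le (by positivity) b1, rpow_div_le (by positivity) (by exact_mod_cast b2),
      rpow_div_le (by positivity) (by exact_mod_cast b3)⟩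

end PosetEntropy

/-! ### Counting linear extensions by their top element -/

namespace PosetEntropy

/-- The linear extensions of a finite subset of a poset, listed from top to bottom. -/
abbrev TopDown {Q : Type*} [PartialOrder Q] (S : Finset Q) : Type _ :=
  {l : List Q // l.Nodup ∧ (∀ v, v ∈ l ↔ v ∈ S) ∧ l.Pairwise fun u v => ¬ u < v}

instance {Q : Type*} [PartialOrder Q] [Finite Q] (S : Finset Q) : Finite (TopDown S) := by
  classical
  have := Fintype.ofFinite Q
  refine Finite.of_injective (β := {l : List Q // l.Nodup}) (fun l => ⟨l.1, l.2.1⟩) ?_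
  intro l l' h
  exact Subtype.ext (Subtype.mk.inj h)

section

variable {Q : Type*} [PartialOrder Q] [DecidableEq Q]

/-- Adding a maximal element on top. -/
def TopDown.cons {S : Finset Q} {m : Q} (hm : m ∈ S) (hmax : ∀ v ∈ S, ¬ m < v)
    (l : TopDown (S.erase m)) : TopDown S :=
  ⟨m :: l.1, by
    obtain ⟨l, h1, h2, h3⟩ := l
    refine ⟨List.nodup_cons.2 ⟨fun h => by simpa using (h2 m).1 h, h1⟩, fun v => ?_,
      List.pairwise_cons.2 ⟨fun v hv => hmax v (Finset.mem_of_mem_erase ((h2 v).1 hv)), h3⟩⟩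
    rw [List.mem_cons, h2, Finset.mem_erase]
    constructor
    · rintro (rfl | h)
      · exact hm
      · exact h.2
    · intro h
      by_cases e : v = m
      · exact Or.inl e
      · exact Or.inr ⟨e, h⟩⟩

theorem TopDown.cons_injective {S : Finset Q} {m : Q} (hm : m ∈ S) (hmax : ∀ v ∈ S, ¬ m < v) :
    Function.Injective (TopDown.cons hm hmax) := by
  intro l l' h
  have := congrArg Subtype.val h
  exact Subtype.ext (List.cons_injective this)

variable [Finite Q]

theorem card_topDown_erase_le {S : Finset Q} {m : Q} (hm : m ∈ S) (hmax : ∀ v ∈ S, ¬ m < v) :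
    Nat.card (TopDown (S.erase m)) ≤ Nat.card (TopDown S) :=
  Nat.card_le_card_of_injective _ (TopDown.cons_injective hm hmax)

theorem card_topDown_erase_add_le {S : Finset Q} {m m' : Q} (hm : m ∈ S)
    (hmax : ∀ v ∈ S, ¬ m < v) (hm' : m' ∈ S) (hmax' : ∀ v ∈ S, ¬ m' < v) (hne : m ≠ m') :
    Nat.card (TopDown (S.erase m)) + Nat.card (TopDown (S.erase m')) ≤ Nat.card (TopDown S) := by
  rw [← Nat.card_sum]
  refine Nat.card_le_card_of_injective
    (Sum.elim (TopDown.cons hm hmax) (TopDown.cons hm' hmax')) ?_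
  refine Function.Injective.sumElim (TopDown.cons_injective hm hmax)
    (TopDown.cons_injective hm' hmax') ?_
  intro l l' h
  have := congrArg Subtype.val h
  exact hne (List.cons.inj this).1

theorem one_le_card_topDown (S : Finset Q) : 1 ≤ Nat.card (TopDown S) := by
  induction S using Finset.strongInduction with
  | H S ih =>
    rcases S.eq_empty_or_nonempty with rfl | hS
    · have : Nonempty (TopDown (∅ : Finset Q)) := ⟨⟨[], by simp⟩⟩
      exact Nat.card_pos
    · obtain ⟨m, hm⟩ := S.exists_maximal hS
      exact (ih _ (Finset.erase_ssubset hm.1)).trans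
        (card_topDown_erase_le hm.1 fun v hv h => hm.not_gt hv h)

end

/-- Each list is recovered from its order, as permutations of one another sorted by the same
antisymmetric relation coincide. -/
theorem card_topDown_univ_le {Q : Type*} [PartialOrder Q] [Fintype Q] :
    Nat.card (TopDown (Finset.univ : Finset Q)) ≤ numLinearExtensions Q := by
  classical
  have hidx : ∀ l : TopDown (Finset.univ : Finset Q), l.1.Pairwise
      fun u v => l.1.idxOf u ≤ l.1.idxOf v := by
    rintro ⟨l, h1, h2, h3⟩
    rw [List.pairwise_iff_getElem]
    intro i j hi hj hij
    simp only [h1.idxOf_getElem]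
    exact hij.le
  have hinj : ∀ l : TopDown (Finset.univ : Finset Q), ∀ u v, l.1.idxOf u = l.1.idxOf v → u = v := by
    rintro ⟨l, h1, h2, h3⟩ u v h
    exact (List.idxOf_inj ((h2 u).2 (Finset.mem_univ _))).1 h
  refine Nat.card_le_card_of_injective
    (fun l : TopDown (Finset.univ : Finset Q) =>
      (⟨fun u v => l.1.idxOf v ≤ l.1.idxOf u, ⟨?_, ?_⟩⟩ :
        {r : Q → Q → Prop // IsLinearOrder Q r ∧ ∀ a b, a ≤ b → r a b})) ?_
  · exact
      { refl := fun a => le_rfl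
        trans := fun a b c h1 h2 => h2.trans h1
        antisymm := fun a b h1 h2 => hinj l a b (le_antisymm h2 h1)
        total := fun a b => le_total _ _ }
  · intro a b hab
    rcases hab.eq_or_lt with rfl | hab
    · exact le_rfl
    · by_contra hcon
      push Not at hcon
      obtain ⟨l, h1, h2, h3⟩ := l
      have ha : l.idxOf a < l.length := List.idxOf_lt_length_of_mem ((h2 a).2 (Finset.mem_univ _))
      have hb : l.idxOf b < l.length := List.idxOf_lt_length_of_mem ((h2 b).2 (Finset.mem_univ _))
      have := List.pairwise_iff_getElem.1 h3 _ _ ha hb hcon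
      rw [List.getElem_idxOf, List.getElem_idxOf] at this
      exact this hab
  · intro l l' h
    have hr := congrArg Subtype.val h
    simp only at hr
    have hp : l.1.Perm l'.1 := (List.perm_ext_iff_of_nodup l.2.1 l'.2.1).2 fun v => by
      rw [l.2.2.1, l'.2.2.1]
    apply Subtype.ext
    have h' := hidx l'
    refine hp.eq_of_pairwise (le := fun u v => l.1.idxOf u ≤ l.1.idxOf v) ?_ (hidx l) ?_
    · intro a b _ _ h1 h2
      exact hinj l a b (le_antisymm h1 h2)
    · refine h'.imp fun {u v} huv => ?_
      have := congrFun (congrFun hr v) u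
      rw [this]; exact huv

/-! ### Linear extensions and components -/

/-- An element outside a connected component of the incomparability graph compares in the same way
with all elements of the component. -/
theorem lt_of_reachable {P : Type*} [PartialOrder P] {a b c : P}
    (h : (incompGraph P).Reachable a b) (hc : ¬ (incompGraph P).Reachable a c) (hca : c < a) :
    c < b := by
  obtain ⟨p⟩ := h
  induction p with
  | nil => exact hca
  | @cons u v w huv p ih =>
    have hr : (incompGraph P).Reachable u v := huv.reachable
    have hvc : ¬ (incompGraph P).Reachable v c := fun h => hc (hr.trans h)
    refine ih hvc ?_
    have h1 : ¬ (incompGraph P).Adj v c := fun h => hvc h.reachable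
    have h2 : ¬ (v ≤ c) := fun h => huv.2 (h.trans hca.le)
    have h3 : c ≤ v := by
      by_contra h3
      exact h1 ⟨h2, h3⟩
    exact lt_of_le_of_ne h3 fun e => h2 e.ge

theorem le_total_of_not_reachable {P : Type*} [PartialOrder P] {a c : P}
    (hc : ¬ (incompGraph P).Reachable a c) : a < c ∨ c < a := by
  have hne : a ≠ c := fun e => hc (e ▸ SimpleGraph.Reachable.refl _)
  by_contra h
  push Not at h
  refine hc (SimpleGraph.Adj.reachable (G := incompGraph P) ⟨fun h1 => h.1 (lt_of_le_of_ne h1 hne),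
    fun h1 => h.2 (lt_of_le_of_ne h1 hne.symm)⟩)

theorem lt_of_reachable' {P : Type*} [PartialOrder P] {a b c : P}
    (h : (incompGraph P).Reachable a b) (hc : ¬ (incompGraph P).Reachable a c) (hac : a < c) :
    b < c := by
  rcases le_total_of_not_reachable (a := b) (c := c) fun h' => hc (h.trans h') with h1 | h1
  · exact h1
  · exact absurd (lt_of_reachable h.symm (fun h' => hc (h.trans h')) h1) hac.not_gt

/-- Linear extensions of the components are glued by comparing elements of different components as
in P; this is consistent because whole components lie above or below each other. -/
theorem prod_numLinearExtensions_le (P : Type*) [PartialOrder P] [Fintype P]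
    [Fintype (incompGraph P).ConnectedComponent] :
    ∏ C : (incompGraph P).ConnectedComponent, numLinearExtensions C.supp ≤
      numLinearExtensions P := by
  classical
  unfold numLinearExtensions
  rw [← Nat.card_pi]
  let cc : P → (incompGraph P).ConnectedComponent := (incompGraph P).connectedComponentMk
  have hcc : ∀ a b, cc a = cc b ↔ (incompGraph P).Reachable a b := fun a b =>
    SimpleGraph.ConnectedComponent.eq
  let rel (f : ∀ C : (incompGraph P).ConnectedComponent,
      {r : C.supp → C.supp → Prop // IsLinearOrder C.supp r ∧ ∀ a b, a ≤ b → r a b}) (a b : P) :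
      Prop := if h : cc a = cc b then (f (cc b)).1 ⟨a, h⟩ ⟨b, rfl⟩ else a < b
  have rel_iff : ∀ f C (a b : C.supp), rel f a b ↔ (f C).1 a b := by
    rintro f C ⟨a, ha⟩ ⟨b, hb⟩
    have hb' : cc b = C := hb
    subst hb'
    have ha' : cc a = cc b := ha
    simp only [rel]
    rw [dif_pos ha']
  have rel_of_ne : ∀ f a b, cc a ≠ cc b → (rel f a b ↔ a < b) := by
    intro f a b h
    simp only [rel]
    rw [dif_neg h]
  refine Nat.card_le_card_of_injective (fun f => ⟨rel f, ?_, ?_⟩) ?_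
  · have hrefl : ∀ a, rel f a a := fun a =>
      (rel_iff f (cc a) ⟨a, rfl⟩ ⟨a, rfl⟩).2 ((f (cc a)).2.1.refl _)
    have htotal : ∀ a b, rel f a b ∨ rel f b a := by
      intro a b
      by_cases h : cc a = cc b
      · rw [rel_iff f (cc b) ⟨a, h⟩ ⟨b, rfl⟩, rel_iff f (cc b) ⟨b, rfl⟩ ⟨a, h⟩]
        exact (f (cc b)).2.1.total _ _
      · rw [rel_of_ne f a b h, rel_of_ne f b a (Ne.symm h)]
        exact le_total_of_not_reachable fun h' => h ((hcc a b).2 h')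
    have hanti : ∀ a b, rel f a b → rel f b a → a = b := by
      intro a b
      by_cases h : cc a = cc b
      · rw [rel_iff f (cc b) ⟨a, h⟩ ⟨b, rfl⟩, rel_iff f (cc b) ⟨b, rfl⟩ ⟨a, h⟩]
        intro h1 h2
        exact congrArg Subtype.val ((f (cc b)).2.1.antisymm _ _ h1 h2)
      · rw [rel_of_ne f a b h, rel_of_ne f b a (Ne.symm h)]
        intro h1 h2
        exact absurd h2 h1.not_gt
    have htrans : ∀ a b c, rel f a b → rel f b c → rel f a c := by
      intro a b c
      by_cases h : cc a = cc b
      · by_cases h' : cc b = cc c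
        · rw [rel_iff f (cc c) ⟨a, h.trans h'⟩ ⟨b, h'⟩, rel_iff f (cc c) ⟨b, h'⟩ ⟨c, rfl⟩,
            rel_iff f (cc c) ⟨a, h.trans h'⟩ ⟨c, rfl⟩]
          exact (f (cc c)).2.1.trans _ _ _
        · have h'' : cc a ≠ cc c := fun e => h' (h.symm.trans e)
          rw [rel_of_ne f b c h', rel_of_ne f a c h'']
          intro _ h2
          exact lt_of_reachable' ((hcc b a).1 h.symm) (fun e => h' ((hcc b c).2 e)) h2
      · rw [rel_of_ne f a b h]
        by_cases h' : cc b = cc c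
        · have h'' : cc a ≠ cc c := fun e => h (e.trans h'.symm)
          rw [rel_of_ne f a c h'']
          intro h1 _
          exact lt_of_reachable ((hcc b c).1 h') (fun e => h ((hcc b a).2 e).symm) h1
        · rw [rel_of_ne f b c h']
          intro h1 h2
          by_cases h'' : cc a = cc c
          · exact absurd (lt_of_reachable' ((hcc a c).1 h'') (fun e => h ((hcc a b).2 e)) h1)
              h2.not_gt
          · rw [rel_of_ne f a c h'']
            exact h1.trans h2
    exact { refl := hrefl, trans := htrans, antisymm := hanti, total := htotal }
  · intro a b hab
    by_cases h : cc a = cc b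
    · rw [rel_iff f (cc b) ⟨a, h⟩ ⟨b, rfl⟩]
      exact (f (cc b)).2.2 _ _ hab
    · rw [rel_of_ne f a b h]
      exact lt_of_le_of_ne hab fun e => h (e ▸ rfl)
  · intro f g hfg
    have hr : rel f = rel g := congrArg Subtype.val hfg
    funext C
    apply Subtype.ext
    funext a b
    have := rel_iff f C a b
    rw [hr, rel_iff g C a b] at this
    exact propext this.symm

end PosetEntropy

/-! ### The stable set polytope of a bipartite graph; partition into two chains -/

namespace PosetEntropy

open MeasureTheory

/-- Choose a uniform threshold θ in [0, 1]; take the vertices of one colour with θ < x v and those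
of the other with θ ≥ 1 - x v. This set is always stable, and v belongs to it with probability x v,
so x is an average of characteristic vectors. -/
theorem mem_stab_of_coloring {V : Type*} [Fintype V] (G : SimpleGraph V) (col : V → Bool)
    (hcol : ∀ u v, G.Adj u v → col u ≠ col v) (x : V → ℝ) (h0 : ∀ v, 0 ≤ x v) (h1 : ∀ v, x v ≤ 1)
    (hx : ∀ u v, G.Adj u v → x u + x v ≤ 1) : x ∈ stab G := by
  let T : V → Set ℝ := fun v => if col v then Set.Iio (x v) else Set.Ici (1 - x v)
  have hT : ∀ v, MeasurableSet (T v) := by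
    intro v
    simp only [T]
    split_ifs
    · exact measurableSet_Iio
    · exact measurableSet_Ici
  let μ : Measure ℝ := volume.restrict (Set.Icc 0 1)
  have : IsProbabilityMeasure μ := ⟨by simp [μ]⟩
  let f : ℝ → V → ℝ := fun θ v => (T v).indicator 1 θ
  have hf : ∀ v, Integrable (fun θ => f θ v) μ := fun v =>
    (integrable_const (1 : ℝ)).indicator (hT v)
  have hfi : Integrable f μ := Integrable.of_eval hf
  have hmem : ∀ θ, f θ ∈ stab G := by
    intro θ
    apply subset_convexHull
    refine ⟨{v | θ ∈ T v}, ?_, ?_⟩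
    · have key : ∀ u v, θ ∈ T u → θ ∈ T v → col u = true → col v = false → ¬ G.Adj u v := by
        intro u v hu hv h2 h3 hadj
        simp only [T, h2, h3, if_true, Bool.false_eq_true, if_false, Set.mem_Iio,
          Set.mem_Ici] at hu hv
        linarith [hx u v hadj]
      intro u hu v hv _ hadj
      have hne := hcol u v hadj
      rcases hu' : col u with _ | _ <;> rcases hv' : col v with _ | _
      · exact hne (hu'.trans hv'.symm)
      · exact key v u hv hu hv' hu' hadj.symm
      · exact key u v hu hv hu' hv' hadj
      · exact hne (hu'.trans hv'.symm)
    · funext v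
      rfl
  have hint : ∫ θ, f θ ∂μ = x := by
    funext v
    rw [eval_integral (fun v => hf v)]
    simp only [f]
    rw [integral_indicator_one (hT v)]
    simp only [T, μ]
    split_ifs
    · rw [measureReal_restrict_apply measurableSet_Iio]
      have : Set.Iio (x v) ∩ Set.Icc 0 1 = Set.Ico 0 (x v) := by
        ext t
        simp only [Set.mem_inter_iff, Set.mem_Iio, Set.mem_Icc, Set.mem_Ico]
        have := h1 v
        constructor
        · rintro ⟨a, b, c⟩; exact ⟨b, a⟩
        · rintro ⟨a, b⟩; exact ⟨b, a, by linarith⟩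
      rw [this, Real.volume_real_Ico_of_le (h0 v), sub_zero]
    · rw [measureReal_restrict_apply measurableSet_Ici]
      have : Set.Ici (1 - x v) ∩ Set.Icc 0 1 = Set.Icc (1 - x v) 1 := by
        ext t
        simp only [Set.mem_inter_iff, Set.mem_Ici, Set.mem_Icc]
        have := h1 v
        constructor
        · rintro ⟨a, b, c⟩; exact ⟨a, c⟩
        · rintro ⟨a, b⟩; exact ⟨a, by linarith, b⟩
      rw [this, Real.volume_real_Icc_of_le (by linarith [h0 v])]
      ring
  rw [← hint]
  exact (convex_convexHull ℝ _).integral_mem (isCompact_stab G).isClosed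
    (Filter.Eventually.of_forall hmem) hfi

/-- Dilworth's theorem for width 2, by removing a maximal element m. In each colour take the largest
element that has an incomparable partner; these two are incomparable, so one of them lies below m.
-/
theorem exists_coloring_of_finset {P : Type*} [PartialOrder P] (S : Finset P)
    (hS : ∀ A ⊆ S, IsAntichain (· ≤ ·) (A : Set P) → A.card ≤ 2) :
    ∃ col : P → Bool, ∀ u ∈ S, ∀ v ∈ S, (incompGraph P).Adj u v → col u ≠ col v := by
  classical
  induction S using Finset.strongInduction with
  | H S ih =>
  rcases S.eq_empty_or_nonempty with rfl | hne
  · exact ⟨fun _ => true, by simp⟩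
  obtain ⟨m, hm⟩ := S.exists_maximal hne
  obtain ⟨col, hcol⟩ := ih (S.erase m) (Finset.erase_ssubset hm.1) fun A hA =>
    hS A (hA.trans (Finset.erase_subset _ _))
  set S' := S.erase m with hS'
  have hmem : ∀ v ∈ S, v ≠ m → v ∈ S' := fun v hv h => Finset.mem_erase.2 ⟨h, hv⟩
  have hchain : ∀ u ∈ S', ∀ v ∈ S', col u = col v → u ≤ v ∨ v ≤ u := by
    intro u hu v hv h
    by_contra hcon
    push Not at hcon
    exact hcol u hu v hv ⟨hcon.1, hcon.2⟩ h
  -- The new chain is m together with the elements of colour b below x. The elements of colour b not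
  -- below x have no incomparable partner in `S'`, so they may join the other chain.
  have finish : ∀ (b : Bool) (x : P), (∀ z ∈ S', z ≤ x → z < m) → x ∈ S' → col x = b →
      (∀ z ∈ S', col z = b → (∃ y ∈ S', (incompGraph P).Adj z y) → z ≤ x) →
      ∃ col : P → Bool, ∀ u ∈ S, ∀ v ∈ S, (incompGraph P).Adj u v → col u ≠ col v := by
    intro b x hxm hx hb hmax
    refine ⟨fun v => decide (v = m ∨ (col v = b ∧ v ≤ x)), ?_⟩
    have key : ∀ u ∈ S, ∀ v ∈ S, (incompGraph P).Adj u v → u = m ∨ (col u = b ∧ u ≤ x) →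
        ¬ (v = m ∨ (col v = b ∧ v ≤ x)) := by
      rintro u hu v hv hadj (rfl | ⟨h1, h2⟩) (rfl | ⟨h3, h4⟩)
      · exact hadj.1 le_rfl
      · exact hadj.2 (hxm v (hmem v hv hadj.ne') h4).le
      · exact hadj.1 (hxm u (hmem u hu hadj.ne) h2).le
      · by_cases e1 : u = m
        · subst e1
          exact hadj.2 (hxm v (hmem v hv hadj.ne') h4).le
        by_cases e2 : v = m
        · subst e2
          exact hadj.1 (hxm u (hmem u hu e1) h2).le
        exact hcol u (hmem u hu e1) v (hmem v hv e2) hadj (h1.trans h3.symm)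
    intro u hu v hv hadj heq
    simp only [decide_eq_decide] at heq
    by_cases h : u = m ∨ (col u = b ∧ u ≤ x)
    · exact key u hu v hv hadj h (heq.1 h)
    · have h' : ¬ (v = m ∨ (col v = b ∧ v ≤ x)) := fun g => h (heq.2 g)
      push Not at h h'
      have hu' := hmem u hu h.1
      have hv' := hmem v hv h'.1
      have hne := hcol u hu' v hv' hadj
      by_cases e : col u = b
      · exact h.2 e (hmax u hu' e ⟨v, hv', hadj⟩)
      · have e' : col v = b := by
          revert hne e
          cases col u <;> cases col v <;> cases b <;> simp
        exact h'.2 e' (hmax v hv' e' ⟨u, hu', hadj.symm⟩)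
  by_cases hinc : ∃ u ∈ S', ∃ v ∈ S', (incompGraph P).Adj u v
  · have hex : ∀ b : Bool, ∃ x ∈ S', col x = b ∧ (∃ y ∈ S', (incompGraph P).Adj x y) ∧
        ∀ z ∈ S', col z = b → (∃ y ∈ S', (incompGraph P).Adj z y) → z ≤ x := by
      intro b
      have hne : (S'.filter fun z => col z = b ∧ ∃ y ∈ S', (incompGraph P).Adj z y).Nonempty := by
        obtain ⟨u, hu, v, hv, hadj⟩ := hinc
        have hne := hcol u hu v hv hadj
        by_cases e : col u = b
        · exact ⟨u, Finset.mem_filter.2 ⟨hu, e, v, hv, hadj⟩⟩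
        · refine ⟨v, Finset.mem_filter.2 ⟨hv, ?_, u, hu, hadj.symm⟩⟩
          revert hne e
          cases col u <;> cases col v <;> cases b <;> simp
      obtain ⟨x, hx⟩ := Finset.exists_maximal hne
      obtain ⟨hx1, hx2, hx3⟩ := Finset.mem_filter.1 hx.1
      refine ⟨x, hx1, hx2, hx3, fun z hz h1 h2 => ?_⟩
      rcases hchain z hz x hx1 (h1.trans hx2.symm) with h | h
      · exact h
      · exact hx.2 (Finset.mem_filter.2 ⟨hz, h1, h2⟩) h
    obtain ⟨x, hx, hxb, hxy, hxmax⟩ := hex true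
    obtain ⟨y, hy, hyb, hyx, hymax⟩ := hex false
    have hxy' : (incompGraph P).Adj x y := by
      constructor
      · intro h
        obtain ⟨z, hz, hadj⟩ := hyx
        have : col z = true := by
          have := hcol y hy z hz hadj
          rw [hyb] at this
          revert this
          cases col z <;> simp
        exact hadj.2 ((hxmax z hz this ⟨y, hy, hadj.symm⟩).trans h)
      · intro h
        obtain ⟨z, hz, hadj⟩ := hxy
        have : col z = false := by
          have := hcol x hx z hz hadj
          rw [hxb] at this
          revert this
          cases col z <;> simp
        exact hadj.2 ((hymax z hz this ⟨x, hx, hadj.symm⟩).trans h)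
    have hxm := Finset.ne_of_mem_erase hx
    have hym := Finset.ne_of_mem_erase hy
    have hxS := Finset.mem_of_mem_erase hx
    have hyS := Finset.mem_of_mem_erase hy
    have hlt : x < m ∨ y < m := by
      by_contra hcon
      push Not at hcon
      have hcard : ({m, x, y} : Finset P).card = 3 := by
        rw [Finset.card_eq_three]
        exact ⟨m, x, y, hxm.symm, hym.symm, hxy'.ne, rfl⟩
      have h3 := hS {m, x, y} (by
        intro v hv
        simp only [Finset.mem_insert, Finset.mem_singleton] at hv
        rcases hv with rfl | rfl | rfl
        · exact hm.1
        · exact hxS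
        · exact hyS) (by
        have a1 : ¬ m ≤ x := fun h => hm.not_gt hxS (lt_of_le_of_ne h hxm.symm)
        have a2 : ¬ m ≤ y := fun h => hm.not_gt hyS (lt_of_le_of_ne h hym.symm)
        have a3 : ¬ x ≤ m := fun h => hcon.1 (lt_of_le_of_ne h hxm)
        have a4 : ¬ y ≤ m := fun h => hcon.2 (lt_of_le_of_ne h hym)
        have a5 := hxy'.1
        have a6 := hxy'.2
        intro u hu v hv hne
        simp only [Finset.coe_insert, Finset.coe_singleton, Set.mem_insert_iff,
          Set.mem_singleton_iff] at hu hv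
        rcases hu with rfl | rfl | rfl <;> rcases hv with rfl | rfl | rfl <;>
          first | exact absurd rfl hne | assumption)
      omega
    rcases hlt with h | h
    · exact finish true x (fun z _ hz => hz.trans_lt h) hx hxb hxmax
    · exact finish false y (fun z _ hz => hz.trans_lt h) hy hyb hymax
  · push Not at hinc
    refine ⟨fun v => decide (v = m), fun u hu v hv hadj heq => ?_⟩
    simp only [decide_eq_decide] at heq
    by_cases e : u = m
    · exact hadj.ne (e.trans (heq.1 e).symm)
    · exact hinc u (hmem u hu e) v (hmem v hv fun h => e (heq.2 h)) hadj

theorem HasWidth.exists_coloring {P : Type*} [Fintype P] [PartialOrder P] (hP : HasWidth P 2) :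
    ∃ col : P → Bool, ∀ u v, (incompGraph P).Adj u v → col u ≠ col v := by
  obtain ⟨col, h⟩ := exists_coloring_of_finset (Finset.univ : Finset P) fun A _ hA =>
    hP.2 ⟨A, hA, rfl⟩
  exact ⟨col, fun u v => h u (Finset.mem_univ _) v (Finset.mem_univ _)⟩

end PosetEntropy

/-! ### Optimal points and the tilings they define -/

namespace PosetEntropy

open Real Filter Topology

/-- A point of the edge polytope of `G` that maximizes the product of its coordinates. -/
structure IsOptimal {V : Type*} [Fintype V] (G : SimpleGraph V) (x : V → ℝ) : Prop where
  pos : ∀ v, 0 < x v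
  le_one : ∀ v, x v ≤ 1
  edge : ∀ u v, G.Adj u v → x u + x v ≤ 1
  max : ∀ y : V → ℝ, (∀ v, 0 < y v) → (∀ v, y v ≤ 1) → (∀ u v, G.Adj u v → y u + y v ≤ 1) →
    ∑ v, log (y v) ≤ ∑ v, log (x v)

theorem exists_isOptimal {V : Type*} [Fintype V] (G : SimpleGraph V) : ∃ x, IsOptimal G x := by
  let K : Set (V → ℝ) :=
    {x | x ∈ Set.Icc (0 : V → ℝ) 1} ∩ ⋂ u, ⋂ v, {x | G.Adj u v → x u + x v ≤ 1}
  have hK : IsCompact K := by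
    apply isCompact_Icc.inter_right
    refine isClosed_iInter fun u => isClosed_iInter fun v => ?_
    by_cases h : G.Adj u v
    · simp only [h, true_imp_iff]
      exact isClosed_le (by fun_prop) (by fun_prop)
    · simp only [h, false_imp_iff]
      exact isClosed_univ
  have memK : ∀ y : V → ℝ, (∀ v, 0 ≤ y v) → (∀ v, y v ≤ 1) →
      (∀ u v, G.Adj u v → y u + y v ≤ 1) → y ∈ K := fun y h1 h2 h3 =>
    ⟨⟨h1, h2⟩, Set.mem_iInter.2 fun u => Set.mem_iInter.2 fun v => h3 u v⟩
  have hhalf : (fun _ => 1 / 2 : V → ℝ) ∈ K :=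
    memK _ (fun _ => by norm_num) (fun _ => by norm_num) (fun _ _ _ => by norm_num)
  obtain ⟨x, hx, hmax⟩ := hK.exists_isMaxOn ⟨_, hhalf⟩ (f := fun x : V → ℝ => ∏ v, x v)
    (by fun_prop)
  have hprod : 0 < ∏ v, x v := lt_of_lt_of_le (Finset.prod_pos fun _ _ => by norm_num) (hmax hhalf)
  have hpos : ∀ v, 0 < x v := fun v => lt_of_le_of_ne (hx.1.1 v) fun h0 =>
    hprod.ne' (Finset.prod_eq_zero (Finset.mem_univ v) h0.symm)
  refine ⟨x, hpos, hx.1.2, fun u v => Set.mem_iInter.1 (Set.mem_iInter.1 hx.2 u) v, ?_⟩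
  intro y h1 h2 h3
  rw [← log_prod fun v _ => (h1 v).ne', ← log_prod fun v _ => (hpos v).ne']
  exact log_le_log (Finset.prod_pos fun v _ => h1 v) (hmax (memK y (fun v => (h1 v).le) h2 h3))

/-- First-order optimality: if all tight edges from `S` lead to `T`, then `S` does not outweigh
`T`. -/
theorem IsOptimal.sum_inv_le {V : Type*} [Fintype V] {G : SimpleGraph V} {x : V → ℝ}
    (hx : IsOptimal G x) (S T : Finset V) (hST : Disjoint S T) (hS : ∀ v ∈ S, x v < 1)
    (h : ∀ u ∈ S, ∀ v, G.Adj u v → x u + x v = 1 → v ∈ T) :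
    ∑ v ∈ S, 1 / x v ≤ ∑ v ∈ T, 1 / x v := by
  classical
  by_contra hcon
  push Not at hcon
  -- The direction raises S and lowers T at unit rate. By `h` no tight edge constraint is violated
  -- along it, and the derivative of the objective is the difference of the two sums.
  let d : V → ℝ := fun v => (if v ∈ S then 1 else 0) - (if v ∈ T then 1 else 0)
  have hd1 : ∀ v ∉ S, d v ≤ 0 := by
    intro v hv
    simp only [d, if_neg hv]
    split_ifs <;> norm_num
  have hd2 : ∀ v, d v ≤ 1 := by
    intro v
    simp only [d]
    split_ifs <;> norm_num
  have hd3 : ∀ v ∈ T, d v = -1 := by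
    intro v hv
    simp only [d, if_pos hv, if_neg (Finset.disjoint_right.1 hST hv)]
    norm_num
  let F : ℝ → ℝ := fun t => ∑ v, log (x v + t * d v)
  have hF : HasDerivAt F (∑ v, d v / x v) 0 := by
    apply HasDerivAt.fun_sum
    intro v _
    have h1 : HasDerivAt (fun t : ℝ => x v + t * d v) (d v) 0 := by
      simpa using ((hasDerivAt_id (0 : ℝ)).mul_const (d v)).const_add (x v)
    have := h1.log (by simpa using (hx.pos v).ne')
    simpa using this
  have hsum : ∑ v, d v / x v = ∑ v ∈ S, 1 / x v - ∑ v ∈ T, 1 / x v := by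
    simp only [d, sub_div, Finset.sum_sub_distrib, ite_div, zero_div]
    simp
  have hpos : 0 < ∑ v, d v / x v := by rw [hsum]; linarith
  have hslope := (hasDerivAt_iff_tendsto_slope.1 hF).eventually (lt_mem_nhds hpos)
  have hslope' : ∀ᶠ t in 𝓝[>] (0 : ℝ), 0 < slope F 0 t :=
    hslope.filter_mono (nhdsWithin_mono _ fun t (ht : 0 < t) => ht.ne')
  have hcont : ∀ v, Tendsto (fun t : ℝ => x v + t * d v) (𝓝[>] 0) (𝓝 (x v)) := by
    intro v
    have : Continuous fun t : ℝ => x v + t * d v := by fun_prop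
    have h2 := (this.tendsto 0).mono_left (nhdsWithin_le_nhds (s := Set.Ioi 0))
    simpa using h2
  have e1 : ∀ᶠ t in 𝓝[>] (0 : ℝ), ∀ v, 0 < x v + t * d v :=
    eventually_all.2 fun v => (hcont v).eventually (lt_mem_nhds (hx.pos v))
  have e2 : ∀ᶠ t in 𝓝[>] (0 : ℝ), ∀ v, x v + t * d v ≤ 1 := by
    refine eventually_all.2 fun v => ?_
    by_cases hv : v ∈ S
    · exact ((hcont v).eventually (gt_mem_nhds (hS v hv))).mono fun t ht => ht.le
    · filter_upwards [self_mem_nhdsWithin] with t (ht : 0 < t)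
      nlinarith [hd1 v hv, hx.le_one v]
  have e3 : ∀ᶠ t in 𝓝[>] (0 : ℝ), ∀ u v, G.Adj u v → (x u + t * d u) + (x v + t * d v) ≤ 1 := by
    refine eventually_all.2 fun u => eventually_all.2 fun v => ?_
    by_cases hadj : G.Adj u v
    · rcases (hx.edge u v hadj).eq_or_lt with heq | hlt
      · have hd : d u + d v ≤ 0 := by
          by_cases hu : u ∈ S
          · rw [hd3 v (h u hu v hadj heq)]; linarith [hd2 u]
          · by_cases hv : v ∈ S
            · rw [hd3 u (h v hv u hadj.symm (by rw [add_comm]; exact heq))]; linarith [hd2 v]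
            · linarith [hd1 u hu, hd1 v hv]
        filter_upwards [self_mem_nhdsWithin] with t (ht : 0 < t) _
        nlinarith
      · exact (((hcont u).add (hcont v)).eventually (gt_mem_nhds hlt)).mono fun t ht _ => ht.le
    · exact Eventually.of_forall fun t h => absurd h hadj
  obtain ⟨t, ht0, ht1, ht2, ht3, ht4⟩ :=
    (((eventually_mem_nhdsWithin (a := (0 : ℝ)) (s := Set.Ioi 0)).and
      (hslope'.and (e1.and (e2.and e3)))).exists)
  have hle := hx.max (fun v => x v + t * d v) ht2 ht3 ht4
  have hF0 : F 0 = ∑ v, log (x v) := by simp [F]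
  have hle' : F t ≤ F 0 := by rw [hF0]; exact hle
  rw [slope_def_field] at ht1
  have ht0' : (0 : ℝ) < t := ht0
  have : (F t - F 0) / (t - 0) ≤ 0 := div_nonpos_of_nonpos_of_nonneg (by linarith) (by linarith)
  linarith

/-- A partition of a poset into two enumerated chains. -/
structure TwoChains (Q : Type*) [PartialOrder Q] where
  p : ℕ
  q : ℕ
  a : ℕ → Q
  b : ℕ → Q
  a_lt : ∀ i i', i < i' → i' < p → a i < a i'
  b_lt : ∀ j j', j < j' → j' < q → b j < b j'
  ne : ∀ i j, i < p → j < q → a i ≠ b j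
  cover : ∀ v, (∃ i < p, a i = v) ∨ ∃ j < q, b j = v

namespace TwoChains

variable {Q : Type*} [PartialOrder Q]

/-- Exchanging the two chains. -/
def swap (D : TwoChains Q) : TwoChains Q where
  p := D.q
  q := D.p
  a := D.b
  b := D.a
  a_lt := D.b_lt
  b_lt := D.a_lt
  ne := fun j i hj hi => (D.ne i j hi hj).symm
  cover := fun v => (D.cover v).symm

variable (D : TwoChains Q)

/-- Incomparability of the `i`-th element of the first chain and the `j`-th element of the second
one. -/
def inc (i j : ℕ) : Prop := (incompGraph Q).Adj (D.a i) (D.b j)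

theorem inc_swap {i j : ℕ} : D.swap.inc j i ↔ D.inc i j :=
  ⟨fun h => SimpleGraph.Adj.symm (G := incompGraph Q) h,
    fun h => SimpleGraph.Adj.symm (G := incompGraph Q) h⟩

theorem a_le {i i' : ℕ} (h : i ≤ i') (h' : i' < D.p) : D.a i ≤ D.a i' := by
  rcases h.eq_or_lt with rfl | h
  · exact le_rfl
  · exact (D.a_lt i i' h h').le

theorem b_le {j j' : ℕ} (h : j ≤ j') (h' : j' < D.q) : D.b j ≤ D.b j' := D.swap.a_le h h'

theorem a_inj {i i' : ℕ} (hi : i < D.p) (hi' : i' < D.p) (h : D.a i = D.a i') : i = i' := by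
  rcases lt_trichotomy i i' with h1 | h1 | h1
  · exact absurd h (D.a_lt i i' h1 hi').ne
  · exact h1
  · exact absurd h (D.a_lt i' i h1 hi).ne'

theorem b_inj {j j' : ℕ} (hj : j < D.q) (hj' : j' < D.q) (h : D.b j = D.b j') : j = j' :=
  D.swap.a_inj hj hj' h

theorem not_adj_a {i i' : ℕ} (hi : i < D.p) (hi' : i' < D.p) :
    ¬ (incompGraph Q).Adj (D.a i) (D.a i') := by
  intro h
  rcases le_total i i' with h1 | h1
  · exact h.1 (D.a_le h1 hi')
  · exact h.2 (D.a_le h1 hi)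

/-- Two incomparable pairs at opposite corners of an index rectangle make every pair in it
incomparable. -/
theorem rect {i i' j j' m s : ℕ} (h1 : D.inc i j') (h2 : D.inc i' j) (him : i ≤ m) (hmi : m ≤ i')
    (hjs : j ≤ s) (hsj : s ≤ j') (hi' : i' < D.p) (hj' : j' < D.q) : D.inc m s :=
  ⟨fun h => h1.1 ((D.a_le him (hmi.trans_lt hi')).trans (h.trans (D.b_le hsj hj'))),
    fun h => h2.2 ((D.b_le hjs (hsj.trans_lt hj')).trans (h.trans (D.a_le hmi hi')))⟩

section Counting

variable [DecidableEq Q]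

/-- The union of two initial segments of the chains. -/
def initial (i j : ℕ) : Finset Q := (Finset.range i).image D.a ∪ (Finset.range j).image D.b

theorem initial_swap (i j : ℕ) : D.swap.initial j i = D.initial i j := Finset.union_comm _ _

theorem mem_initial {i j : ℕ} {v : Q} :
    v ∈ D.initial i j ↔ (∃ k < i, D.a k = v) ∨ ∃ k < j, D.b k = v := by
  simp [initial]

theorem erase_initial {i j : ℕ} (hi : i < D.p) (hj : j ≤ D.q) :
    (D.initial (i + 1) j).erase (D.a i) = D.initial i j := by
  ext v
  rw [Finset.mem_erase, mem_initial, mem_initial]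
  constructor
  · rintro ⟨h0, ⟨k, hk, rfl⟩ | h⟩
    · refine Or.inl ⟨k, lt_of_le_of_ne (Nat.lt_succ_iff.1 hk) ?_, rfl⟩
      rintro rfl
      exact h0 rfl
    · exact Or.inr h
  · rintro (⟨k, hk, rfl⟩ | ⟨k, hk, rfl⟩)
    · exact ⟨(D.a_lt k i hk hi).ne, Or.inl ⟨k, by omega, rfl⟩⟩
    · exact ⟨(D.ne i k hi (by omega)).symm, Or.inr ⟨k, hk, rfl⟩⟩

theorem maximal_initial {i j : ℕ} (hi : i < D.p) (hj : j < D.q) (h : D.inc i j) :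
    ∀ v ∈ D.initial (i + 1) (j + 1), ¬ D.a i < v := by
  intro v hv hlt
  rcases D.mem_initial.1 hv with ⟨k, hk, rfl⟩ | ⟨k, hk, rfl⟩
  · exact hlt.not_ge (D.a_le (by omega) hi)
  · exact h.1 (hlt.le.trans (D.b_le (by omega) hj))

theorem initial_mono_right (i : ℕ) {j j' : ℕ} (h : j ≤ j') : D.initial i j ⊆ D.initial i j' := by
  intro v hv
  rw [mem_initial] at hv ⊢
  rcases hv with hv | ⟨k, hk, rfl⟩
  · exact Or.inl hv
  · exact Or.inr ⟨k, by omega, rfl⟩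

theorem a_mem_initial (i j : ℕ) : D.a i ∈ D.initial (i + 1) j :=
  D.mem_initial.2 (Or.inl ⟨i, by omega, rfl⟩)

/-- The number of linear extensions of the union of two initial segments. -/
noncomputable def count (i j : ℕ) : ℝ := Nat.card (TopDown (D.initial i j))

theorem count_swap (i j : ℕ) : D.swap.count j i = D.count i j := by
  rw [count, count, initial_swap]

variable [Fintype Q]

theorem initial_eq_univ : D.initial D.p D.q = Finset.univ := by
  ext v
  simpa using D.mem_initial.2 (D.cover v)

theorem count_mono_left {i j : ℕ} (hi : i < D.p) (hj : j < D.q) (h : D.inc i j) :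
    D.count i j ≤ D.count (i + 1) j := by
  unfold count
  rw [← D.erase_initial hi hj.le]
  exact_mod_cast card_topDown_erase_le (D.a_mem_initial i j) fun v hv =>
    D.maximal_initial hi hj h v (D.initial_mono_right _ (Nat.le_succ j) hv)

theorem count_split {i j : ℕ} (hi : i < D.p) (hj : j < D.q) (h : D.inc i j) :
    D.count i (j + 1) + D.count (i + 1) j ≤ D.count (i + 1) (j + 1) := by
  have e1 := D.erase_initial hi hj
  have e2 := D.swap.erase_initial (i := j) (j := i + 1) hj hi
  rw [initial_swap, initial_swap] at e2
  have m2 := D.swap.maximal_initial (i := j) (j := i) hj hi (D.inc_swap.2 h)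
  rw [initial_swap] at m2
  have b2 := D.swap.a_mem_initial j (i + 1)
  rw [initial_swap] at b2
  have := card_topDown_erase_add_le (D.a_mem_initial i (j + 1)) (D.maximal_initial hi hj h) b2 m2
    (D.ne i j hi hj)
  rw [e1, e2] at this
  unfold count
  exact_mod_cast this

theorem count_le_numLinearExtensions : D.count D.p D.q ≤ numLinearExtensions Q := by
  unfold count
  rw [initial_eq_univ]
  exact_mod_cast card_topDown_univ_le

theorem one_le_count (i j : ℕ) : 1 ≤ D.count i j := by
  unfold count
  exact_mod_cast one_le_card_topDown _

end Counting

/-- Connectivity gives an edge leaving the union of the first i + 1 and j + 1 elements of the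
chains. Monotonicity along the chains moves it to an edge between the last elements inside and the
first ones outside. -/
theorem link (hconn : (incompGraph Q).Preconnected) {i j : ℕ} (hi : i + 1 < D.p)
    (hj : j + 1 < D.q) (h : D.inc i j) : D.inc (i + 1) j ∨ D.inc i (j + 1) := by
  by_contra hcon
  push Not at hcon
  let U : Set Q := {v | (∃ k ≤ i, D.a k = v) ∨ ∃ k ≤ j, D.b k = v}
  have h1 : D.a i ∈ U := Or.inl ⟨i, le_rfl, rfl⟩
  have h2 : D.a (i + 1) ∉ U := by
    rintro (⟨k, hk, e⟩ | ⟨k, hk, e⟩)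
    · exact (D.a_lt k (i + 1) (by omega) hi).ne e
    · exact D.ne (i + 1) k hi (by omega) e.symm
  obtain ⟨w⟩ := hconn (D.a i) (D.a (i + 1))
  obtain ⟨d, -, hd1, hd2⟩ := w.exists_boundary_dart U h1 h2
  have hadj := d.adj
  rcases hd1 with ⟨k, hk, e⟩ | ⟨k, hk, e⟩ <;> rcases D.cover d.snd with ⟨m, hm, e'⟩ | ⟨m, hm, e'⟩
  · rw [← e, ← e'] at hadj
    exact D.not_adj_a (by omega) hm hadj
  · rw [← e, ← e'] at hadj
    have hjm : j + 1 ≤ m := by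
      by_contra hlt
      exact hd2 (Or.inr ⟨m, by omega, e'⟩)
    exact hcon.2 ⟨fun g => hadj.1 ((D.a_le hk (by omega)).trans (g.trans (D.b_le hjm hm))),
      fun g => h.2 ((D.b_le (Nat.le_succ j) hj).trans g)⟩
  · rw [← e, ← e'] at hadj
    have him : i + 1 ≤ m := by
      by_contra hlt
      exact hd2 (Or.inl ⟨m, by omega, e'⟩)
    exact hcon.1 ⟨fun g => h.1 ((D.a_le (Nat.le_succ i) hi).trans g),
      fun g => hadj.1 ((D.b_le hk (by omega)).trans (g.trans (D.a_le him hm)))⟩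
  · rw [← e, ← e'] at hadj
    exact D.swap.not_adj_a (i := k) (i' := m) (show k < D.q by omega) hm hadj

section Optimal

variable [Fintype Q] {x : Q → ℝ} (hx : IsOptimal (incompGraph Q) x) (hx1 : ∀ v, x v < 1)

include hx hx1

/-- Otherwise all tight edges from the first i elements of one chain end in the first j of the
other, and raising the former improves the objective. -/
theorem exists_tight {i j : ℕ} (hi : i ≤ D.p) (hj : j ≤ D.q)
    (h : ∑ k ∈ Finset.range j, 1 / x (D.b k) < ∑ k ∈ Finset.range i, 1 / x (D.a k)) :
    ∃ i' j', i' < i ∧ j ≤ j' ∧ j' < D.q ∧ D.inc i' j' ∧ x (D.a i') + x (D.b j') = 1 := by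
  classical
  by_contra hcon
  push Not at hcon
  have hS : ∑ v ∈ (Finset.range i).image D.a, 1 / x v =
      ∑ k ∈ Finset.range i, 1 / x (D.a k) := by
    apply Finset.sum_image
    intro k hk l hl e
    simp only [Finset.coe_range, Set.mem_Iio] at hk hl
    exact D.a_inj (by omega) (by omega) e
  have hT : ∑ v ∈ (Finset.range j).image D.b, 1 / x v =
      ∑ k ∈ Finset.range j, 1 / x (D.b k) := by
    apply Finset.sum_image
    intro k hk l hl e
    simp only [Finset.coe_range, Set.mem_Iio] at hk hl
    exact D.b_inj (by omega) (by omega) e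
  have := hx.sum_inv_le ((Finset.range i).image D.a) ((Finset.range j).image D.b) ?_
    (fun v _ => hx1 v) ?_
  · rw [hS, hT] at this
    linarith
  · rw [Finset.disjoint_left]
    intro v hv hv'
    simp only [Finset.mem_image, Finset.mem_range] at hv hv'
    obtain ⟨k, hk, rfl⟩ := hv
    obtain ⟨l, hl, e⟩ := hv'
    exact D.ne k l (by omega) (by omega) e.symm
  · intro u hu v hadj htight
    simp only [Finset.mem_image, Finset.mem_range] at hu ⊢
    obtain ⟨k, hk, rfl⟩ := hu
    rcases D.cover v with ⟨l, hl, rfl⟩ | ⟨l, hl, rfl⟩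
    · exact absurd hadj (D.not_adj_a (by omega) hl)
    · refine ⟨l, ?_, rfl⟩
      by_contra hlt
      exact hcon k l hk (by omega) hl hadj htight

theorem exists_tight_at {i : ℕ} (hi : i < D.p) :
    ∃ j < D.q, D.inc i j ∧ x (D.a i) + x (D.b j) = 1 := by
  by_contra hcon
  push Not at hcon
  have := hx.sum_inv_le {D.a i} ∅ (by simp) (fun v _ => hx1 v) (by
    intro u hu v hadj htight
    rw [Finset.mem_singleton] at hu
    subst hu
    rcases D.cover v with ⟨l, hl, rfl⟩ | ⟨l, hl, rfl⟩
    · exact absurd hadj (D.not_adj_a hi hl)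
    · exact absurd htight (hcon l hl hadj))
  simp only [Finset.sum_singleton, Finset.sum_empty] at this
  exact absurd this (one_div_pos.2 (hx.pos _)).not_ge

/-- Adding the edge constraints at the other two corners of the rectangle shows that all four
corners are tight. A tight partner of the intermediate element, compared with one of the corners,
gives the remaining inequality. -/
theorem eq_of_tight {i i' i'' j' j'' : ℕ} (h1 : i' ≤ i) (h2 : i ≤ i'') (h3 : j'' ≤ j')
    (hi : i'' < D.p) (hj : j' < D.q) (hI : D.inc i' j') (ht : x (D.a i') + x (D.b j') = 1)
    (hI' : D.inc i'' j'') (ht' : x (D.a i'') + x (D.b j'') = 1) : x (D.a i) = x (D.a i'') := by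
  have r1 := hx.edge _ _ (D.rect hI hI' le_rfl (h1.trans h2) le_rfl h3 hi hj)
  have r2 := hx.edge _ _ (D.rect hI hI' (h1.trans h2) le_rfl h3 le_rfl hi hj)
  have r3 := hx.edge _ _ (D.rect hI hI' h1 h2 h3 le_rfl hi hj)
  obtain ⟨s, hs, hIs, hts⟩ := D.exists_tight_at hx hx1 (h2.trans_lt hi)
  have : x (D.a i'') + x (D.b s) ≤ 1 := by
    rcases le_total j'' s with h | h
    · exact hx.edge _ _ (D.rect hIs hI' h2 le_rfl h le_rfl hi hs)
    · have := hx.edge _ _ (D.rect hI hIs le_rfl h1 le_rfl (h.trans h3) (h2.trans_lt hi) hj)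
      linarith
  linarith

/-- Each of the two strict inequalities yields a tight edge, and the two are opposite corners of a
rectangle containing (i, j). -/
theorem overlap {i j : ℕ} (hi : i < D.p) (hj : j < D.q)
    (h1 : ∑ k ∈ Finset.range i, 1 / x (D.a k) < ∑ k ∈ Finset.range (j + 1), 1 / x (D.b k))
    (h2 : ∑ k ∈ Finset.range j, 1 / x (D.b k) < ∑ k ∈ Finset.range (i + 1), 1 / x (D.a k)) :
    D.inc i j ∧ x (D.a i) + x (D.b j) = 1 := by
  obtain ⟨i', j', hi', hj', hq, hI, ht⟩ := D.exists_tight hx hx1 hi hj.le h2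
  obtain ⟨j'', i'', hj'', hi'', hp, hI', ht'⟩ := D.swap.exists_tight hx hx1 hj hi.le h1
  have hI'' : D.inc i'' j'' := D.inc_swap.1 hI'
  have ht'' : x (D.a i'') + x (D.b j'') = 1 := by rw [add_comm]; exact ht'
  have hi1 : i' ≤ i := by omega
  have hj1 : j'' ≤ j := by omega
  refine ⟨D.rect hI hI'' hi1 hi'' hj1 hj' hp hq, ?_⟩
  have e1 := D.eq_of_tight hx hx1 hi1 hi'' (hj1.trans hj') hp hq hI ht hI'' ht''
  have e2 : x (D.b j) = x (D.b j') := D.swap.eq_of_tight hx hx1 hj1 hj' (hi1.trans hi'') hq hp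
    hI' ht' (D.inc_swap.2 hI) (by rw [add_comm]; exact ht)
  have e3 := D.eq_of_tight hx hx1 le_rfl (hi1.trans hi'') (hj1.trans hj') hp hq hI ht hI'' ht''
  linarith

theorem total_le :
    ∑ k ∈ Finset.range D.p, 1 / x (D.a k) ≤ ∑ k ∈ Finset.range D.q, 1 / x (D.b k) := by
  by_contra hcon
  push Not at hcon
  obtain ⟨i', j', _, h1, h2, _⟩ := D.exists_tight hx hx1 le_rfl le_rfl hcon
  omega

end Optimal

/-- The layout defined by an optimal point for a connected incomparability graph. -/
noncomputable def layout [Fintype Q] [DecidableEq Q] {x : Q → ℝ}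
    (hx : IsOptimal (incompGraph Q) x) (hx1 : ∀ v, x v < 1)
    (hconn : (incompGraph Q).Preconnected) (hp : 0 < D.p) (hq : 0 < D.q) : Layout where
  p := D.p
  q := D.q
  α := fun i => x (D.a i)
  β := fun j => x (D.b j)
  inc := D.inc
  N := D.count
  p_pos := hp
  q_pos := hq
  α_pos := fun _ => hx.pos _
  β_pos := fun _ => hx.pos _
  overlap := fun _ _ hi hj h1 h2 => D.overlap hx hx1 hi hj h1 h2
  total := le_antisymm (D.total_le hx hx1) (D.swap.total_le hx hx1)
  link := fun _ _ hi hj h => D.link hconn hi hj h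
  one_le := D.one_le_count
  split := fun _ _ hi hj h => D.count_split hi hj h
  mono_left := fun _ _ hi hj h => D.count_mono_left hi hj h
  mono_right := fun i j hi hj h => by
    have := D.swap.count_mono_left (i := j) (j := i) hj hi (D.inc_swap.2 h)
    rwa [count_swap, count_swap] at this

end TwoChains

end PosetEntropy

/-! ### The vector on a component and assembly -/

namespace PosetEntropy

open Real

theorem exists_enumeration {Q : Type*} [PartialOrder Q] [Fintype Q] [Nonempty Q] (S : Finset Q)
    (hS : ∀ u ∈ S, ∀ v ∈ S, u ≤ v ∨ v ≤ u) :
    ∃ (p : ℕ) (a : ℕ → Q), (∀ i i', i < i' → i' < p → a i < a i') ∧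
      ∀ v, v ∈ S ↔ ∃ i < p, a i = v := by
  classical
  have hne : Nonempty (TopDown S) := by
    by_contra h
    rw [not_nonempty_iff] at h
    have := one_le_card_topDown S
    rw [Nat.card_of_isEmpty] at this
    omega
  obtain ⟨l, h1, h2, h3⟩ := hne
  have hlt : ∀ i i' (hi : i < i') (hi' : i' < l.reverse.length),
      l.reverse[i] < l.reverse[i'] := by
    have h4 : l.reverse.Pairwise fun u v => u < v := by
      rw [List.pairwise_reverse]
      have h5 : l.Pairwise fun u v => u ≠ v := h1
      refine (h3.and h5).imp_of_mem ?_
      intro u v hu hv ⟨h6, h7⟩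
      rcases hS u ((h2 u).1 hu) v ((h2 v).1 hv) with h | h
      · exact absurd (lt_of_le_of_ne h h7) h6
      · exact lt_of_le_of_ne h h7.symm
    intro i i' hi hi'
    exact List.pairwise_iff_getElem.1 h4 i i' _ hi' hi
  refine ⟨l.reverse.length, fun i => l.reverse.getD i (Classical.arbitrary Q), ?_, ?_⟩
  · intro i i' hi hi'
    simp only
    rw [List.getD_eq_getElem _ _ (hi.trans hi'), List.getD_eq_getElem _ _ hi']
    exact hlt i i' hi hi'
  · intro v
    rw [← h2, ← List.mem_reverse, List.mem_iff_getElem]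
    constructor
    · rintro ⟨i, hi, rfl⟩
      exact ⟨i, hi, List.getD_eq_getElem _ _ hi⟩
    · rintro ⟨i, hi, rfl⟩
      exact ⟨i, hi, (List.getD_eq_getElem _ _ hi).symm⟩

theorem exists_twoChains {Q : Type*} [PartialOrder Q] [Fintype Q] [Nonempty Q] (col : Q → Bool)
    (hcol : ∀ u v, (incompGraph Q).Adj u v → col u ≠ col v) :
    Nonempty (TwoChains Q) := by
  classical
  have hchain : ∀ u v, col u = col v → u ≤ v ∨ v ≤ u := by
    intro u v h
    by_contra hcon
    push Not at hcon
    exact hcol u v ⟨hcon.1, hcon.2⟩ h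
  obtain ⟨p, a, ha, ha'⟩ := exists_enumeration (Finset.univ.filter fun v => col v = true)
    (fun u hu v hv => hchain u v ((Finset.mem_filter.1 hu).2.trans (Finset.mem_filter.1 hv).2.symm))
  obtain ⟨q, b, hb, hb'⟩ := exists_enumeration (Finset.univ.filter fun v => col v = false)
    (fun u hu v hv => hchain u v ((Finset.mem_filter.1 hu).2.trans (Finset.mem_filter.1 hv).2.symm))
  have ca : ∀ i < p, col (a i) = true := fun i hi =>
    (Finset.mem_filter.1 ((ha' _).2 ⟨i, hi, rfl⟩)).2
  have cb : ∀ j < q, col (b j) = false := fun j hj =>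
    (Finset.mem_filter.1 ((hb' _).2 ⟨j, hj, rfl⟩)).2
  refine ⟨⟨p, q, a, b, ha, hb, ?_, ?_⟩⟩
  · intro i j hi hj e
    have := ca i hi
    rw [e, cb j hj] at this
    exact Bool.false_ne_true this
  · intro v
    rcases h : col v with _ | _
    · exact Or.inr ((hb' v).1 (by simpa using h))
    · exact Or.inl ((ha' v).1 (by simpa using h))

theorem TwoChains.sum_eq {Q : Type*} [PartialOrder Q] [Fintype Q] (D : TwoChains Q) (f : Q → ℝ) :
    ∑ v, f v = ∑ i ∈ Finset.range D.p, f (D.a i) + ∑ j ∈ Finset.range D.q, f (D.b j) := by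
  classical
  rw [← D.initial_eq_univ, TwoChains.initial, Finset.sum_union, Finset.sum_image,
    Finset.sum_image]
  · intro k hk l hl e
    simp only [Finset.coe_range, Set.mem_Iio] at hk hl
    exact D.b_inj hk hl e
  · intro k hk l hl e
    simp only [Finset.coe_range, Set.mem_Iio] at hk hl
    exact D.a_inj hk hl e
  · rw [Finset.disjoint_left]
    intro v hv hv'
    simp only [Finset.mem_image, Finset.mem_range] at hv hv'
    obtain ⟨k, hk, rfl⟩ := hv
    obtain ⟨l, hl, e⟩ := hv'
    exact D.ne k l hk hl e.symm

theorem eps_nonneg : 0 ≤ eps := by linarith [two_sub_eps_lt]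

theorem one_le_numLinearExtensions (Q : Type*) [PartialOrder Q] [Fintype Q] :
    1 ≤ numLinearExtensions Q := by
  classical
  exact (one_le_card_topDown _).trans card_topDown_univ_le

/-- The vector used for a connected component of the incomparability graph. -/
theorem exists_vector_of_connected {Q : Type*} [PartialOrder Q] [Fintype Q] (col : Q → Bool)
    (hcol : ∀ u v, (incompGraph Q).Adj u v → col u ≠ col v)
    (hconn : (incompGraph Q).Preconnected) (hcard : 2 ≤ Fintype.card Q) :
    ∃ x : Q → ℝ, (∀ v, 0 < x v) ∧ (∀ v, x v ≤ 1) ∧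
      (∀ u v, (incompGraph Q).Adj u v → x u + x v ≤ 1) ∧
      ∑ v, -logb 2 (x v) ≤ (2 - eps) * logb 2 (numLinearExtensions Q) +
        if Fintype.card Q = 2 then eps else 0 := by
  classical
  have : Nontrivial Q := Fintype.one_lt_card_iff_nontrivial.1 hcard
  obtain ⟨x, hx⟩ := exists_isOptimal (incompGraph Q)
  have hnbr : ∀ v, ∃ u, (incompGraph Q).Adj v u := fun v => hconn.exists_adj_of_nontrivial v
  have hx1 : ∀ v, x v < 1 := by
    intro v
    obtain ⟨u, hu⟩ := hnbr v
    linarith [hx.edge v u hu, hx.pos u]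
  obtain ⟨D⟩ := exists_twoChains col hcol
  have hpq : 0 < D.p ∧ 0 < D.q := by
    have v : Q := Classical.arbitrary Q
    obtain ⟨u, hu⟩ := hnbr v
    rcases D.cover v with ⟨i, hi, rfl⟩ | ⟨i, hi, rfl⟩ <;>
      rcases D.cover u with ⟨j, hj, rfl⟩ | ⟨j, hj, rfl⟩
    · exact absurd hu (D.not_adj_a hi hj)
    · exact ⟨by omega, by omega⟩
    · exact ⟨by omega, by omega⟩
    · exact absurd hu (D.swap.not_adj_a hi hj)
  let L := D.layout hx hx1 hconn hpq.1 hpq.2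
  have hc := two_sub_eps_ge
  have hE := D.count_le_numLinearExtensions
  have hN := D.one_le_count D.p D.q
  refine ⟨fun v => rounding (x v), fun v => rounding_pos (hx.pos v) (hx1 v), ?_, ?_, ?_⟩
  · intro v
    have h1 := rounding_pos (x := 1 - x v) (by linarith [hx1 v]) (by linarith [hx.pos v])
    linarith [rounding_add_rounding_one_sub (x v)]
  · exact fun u v h => rounding_add_le (hx.pos u) (hx.pos v) (hx.edge u v h)
  · rw [D.sum_eq]
    rcases L.bounded weight_isWeight with ⟨hp, hq⟩ | hR
    -- A pair: both entries are 1/2, so the cost is 2 = (2 - ε) + ε, while log e ≥ 1.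
    · have hp' : D.p = 1 := hp
      have hq' : D.q = 1 := hq
      have hcard2 : Fintype.card Q = 2 := by
        have := D.sum_eq fun _ => 1
        rw [hp', hq'] at this
        norm_num at this
        exact_mod_cast this
      have hA : L.A 0 = 0 := rfl
      have hB : L.B 0 = 0 := rfl
      obtain ⟨hI, hs⟩ := L.overlap' L.p_pos L.q_pos (by rw [hA, ← hB]; exact L.B_lt_succ 0)
        (by rw [hB, ← hA]; exact L.A_lt_succ 0)
      have ht := L.A_p
      rw [hp, hq, L.A_succ, L.B_succ, hA, hB, zero_add, zero_add, one_div, one_div, inv_inj] at ht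
      have ha : x (D.a 0) = 1 / 2 := by
        have : L.α 0 = 1 / 2 := by linarith
        exact this
      have hb : x (D.b 0) = 1 / 2 := by
        have : L.β 0 = 1 / 2 := by linarith
        exact this
      have hsp := D.count_split (i := 0) (j := 0) (by omega) (by omega) hI
      have h1 := D.one_le_count 0 1
      have h2 := D.one_le_count 1 0
      rw [hp', hq'] at hE
      have hE2 : (2 : ℝ) ≤ numLinearExtensions Q := by
        norm_num at hsp; linarith
      have hlog : 1 ≤ logb 2 (numLinearExtensions Q : ℝ) := by
        rw [le_logb_iff_rpow_le (by norm_num) (by linarith), rpow_one]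
        exact hE2
      have hr : rounding (1 / 2) = 1 / 2 := rounding_of_lt (by norm_num) (by norm_num)
      simp only
      rw [if_pos hcard2, hp', hq', Finset.sum_range_one, Finset.sum_range_one, ha, hb, hr,
        one_div, logb_inv, logb_self_eq_one (by norm_num)]
      nlinarith
    · have hRlog : L.R weight L.p L.q = 2 ^ ((∑ i ∈ Finset.range D.p,
          -logb 2 (rounding (x (D.a i))) + ∑ j ∈ Finset.range D.q,
          -logb 2 (rounding (x (D.b j)))) / (2 - eps)) := by
        unfold Layout.R weight
        rw [← rpow_sum_of_pos (by norm_num), ← rpow_sum_of_pos (by norm_num),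
          ← rpow_add (by norm_num), add_div, Finset.sum_div, Finset.sum_div]
        rfl
      rw [hRlog] at hR
      have hE' : (2 : ℝ) ^ ((∑ i ∈ Finset.range D.p,
          -logb 2 (rounding (x (D.a i))) + ∑ j ∈ Finset.range D.q,
          -logb 2 (rounding (x (D.b j)))) / (2 - eps)) ≤ numLinearExtensions Q := hR.trans hE
      rw [← le_logb_iff_rpow_le (by norm_num) (by linarith), div_le_iff₀ (by linarith)] at hE'
      have h0 : (0 : ℝ) ≤ if Fintype.card Q = 2 then eps else 0 := by
        split_ifs
        · exact eps_nonneg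
        · exact le_rfl
      linarith

theorem exists_vector_of_component {Q : Type*} [PartialOrder Q] [Fintype Q] (col : Q → Bool)
    (hcol : ∀ u v, (incompGraph Q).Adj u v → col u ≠ col v)
    (hconn : (incompGraph Q).Preconnected) :
    ∃ x : Q → ℝ, (∀ v, 0 < x v) ∧ (∀ v, x v ≤ 1) ∧
      (∀ u v, (incompGraph Q).Adj u v → x u + x v ≤ 1) ∧
      ∑ v, -logb 2 (x v) ≤ (2 - eps) * logb 2 (numLinearExtensions Q) +
        if Fintype.card Q = 2 then eps else 0 := by
  rcases Nat.lt_or_ge (Fintype.card Q) 2 with h | h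
  · have hsub : Subsingleton Q := Fintype.card_le_one_iff_subsingleton.1 (by omega)
    refine ⟨fun _ => 1, fun _ => one_pos, fun _ => le_rfl,
      fun u v hadj => absurd (Subsingleton.elim u v) hadj.ne, ?_⟩
    have h1 : (1 : ℝ) ≤ numLinearExtensions Q := by exact_mod_cast one_le_numLinearExtensions Q
    have h2 := logb_nonneg (b := 2) (by norm_num) h1
    rw [if_neg (by omega)]
    simp only [logb_one, neg_zero, Finset.sum_const_zero, add_zero]
    exact mul_nonneg (by linarith [two_sub_eps_ge]) h2
  · exact exists_vector_of_connected col hcol hconn h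

theorem card_mul_entropyObjective {V : Type*} [Fintype V] (x : V → ℝ) :
    (Fintype.card V : ℝ) * entropyObjective x = ∑ v, -logb 2 (x v) := by
  rcases isEmpty_or_nonempty V with hV | hV
  · simp
  · have : (Fintype.card V : ℝ) ≠ 0 := by exact_mod_cast Fintype.card_ne_zero
    rw [entropyObjective, ← Finset.mul_sum, Finset.sum_neg_distrib]
    field_simp

theorem card_mul_graphEntropy_le {P : Type*} [Fintype P] [PartialOrder P] (col : P → Bool)
    (hcol : ∀ u v, (incompGraph P).Adj u v → col u ≠ col v) :
    (Fintype.card P : ℝ) * graphEntropy (incompGraph P) ≤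
      (2 - eps) * logb 2 (numLinearExtensions P) + eps * kappaTwo P := by
  classical
  have hfin : Fintype (incompGraph P).ConnectedComponent := Fintype.ofFinite _
  have hex : ∀ C : (incompGraph P).ConnectedComponent, ∃ x : C.supp → ℝ, (∀ v, 0 < x v) ∧
      (∀ v, x v ≤ 1) ∧ (∀ u v, (incompGraph C.supp).Adj u v → x u + x v ≤ 1) ∧
      ∑ v, -logb 2 (x v) ≤ (2 - eps) * logb 2 (numLinearExtensions C.supp) +
        if Fintype.card C.supp = 2 then eps else 0 := by
    intro C
    refine exists_vector_of_component (fun v => col v) (fun u v h => hcol u v h) ?_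
    exact C.connected_toSimpleGraph.preconnected
  choose x hx0 hx1 hxe hxs using hex
  let cc : P → (incompGraph P).ConnectedComponent := (incompGraph P).connectedComponentMk
  let y : P → ℝ := fun v => x (cc v) ⟨v, rfl⟩
  have hy : ∀ C (v : C.supp), y v = x C v := by
    rintro C ⟨v, hv⟩
    have hv' : cc v = C := hv
    subst hv'
    rfl
  have hmem : y ∈ stab (incompGraph P) := by
    refine mem_stab_of_coloring _ col hcol y (fun v => (hx0 _ _).le) (fun v => hx1 _ _) ?_
    intro u v hadj
    have hc : cc u = cc v := SimpleGraph.ConnectedComponent.sound hadj.reachable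
    rw [hy (cc v) ⟨u, hc⟩, hy (cc v) ⟨v, rfl⟩]
    exact hxe _ _ _ hadj
  have hle : graphEntropy (incompGraph P) ≤ entropyObjective y :=
    (graphEntropy_isLeast _).2 ⟨y, ⟨hmem, fun v => hx0 _ _⟩, rfl⟩
  have hsum : ∑ v, -logb 2 (y v) =
      ∑ C : (incompGraph P).ConnectedComponent, ∑ v : C.supp, -logb 2 (x C v) := by
    rw [← Finset.sum_fiberwise (s := Finset.univ) (g := cc)]
    refine Finset.sum_congr rfl fun C _ => ?_
    have hmem : ∀ v, v ∈ Finset.univ.filter (fun v => cc v = C) ↔ v ∈ C.supp := fun v =>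
      Finset.mem_filter_univ v
    rw [Finset.sum_subtype _ hmem]
    exact Finset.sum_congr rfl fun v _ => by rw [hy C v]
  have hprod : ∑ C : (incompGraph P).ConnectedComponent, logb 2 (numLinearExtensions C.supp : ℝ) ≤
      logb 2 (numLinearExtensions P) := by
    have hpos : ∀ C : (incompGraph P).ConnectedComponent, 0 < numLinearExtensions C.supp :=
      fun C => one_le_numLinearExtensions _
    rw [← logb_prod _ _ fun C _ => by exact_mod_cast (hpos C).ne']
    apply logb_le_logb_of_le (by norm_num)
    · exact Finset.prod_pos fun C _ => by exact_mod_cast hpos C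
    · exact_mod_cast prod_numLinearExtensions_le P
  have hkappa : ∑ C : (incompGraph P).ConnectedComponent,
      (if Fintype.card C.supp = 2 then eps else 0) = eps * kappaTwo P := by
    rw [← Finset.sum_filter, Finset.sum_const, nsmul_eq_mul, mul_comm, kappaTwo,
      Nat.card_eq_fintype_card, Fintype.card_subtype]
    congr 3
    ext C
    rw [Finset.mem_filter_univ, Finset.mem_filter_univ, Set.ncard_eq_toFinset_card', Set.toFinset_card]
  have hc := two_sub_eps_ge
  calc (Fintype.card P : ℝ) * graphEntropy (incompGraph P)
      ≤ Fintype.card P * entropyObjective y :=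
        mul_le_mul_of_nonneg_left hle (Nat.cast_nonneg _)
    _ = ∑ C : (incompGraph P).ConnectedComponent, ∑ v : C.supp, -logb 2 (x C v) := by
        rw [card_mul_entropyObjective, hsum]
    _ ≤ ∑ C : (incompGraph P).ConnectedComponent,
        ((2 - eps) * logb 2 (numLinearExtensions C.supp) +
          if Fintype.card C.supp = 2 then eps else 0) := Finset.sum_le_sum fun C _ => hxs C
    _ = (2 - eps) * ∑ C : (incompGraph P).ConnectedComponent,
        logb 2 (numLinearExtensions C.supp : ℝ) + eps * kappaTwo P := by
        rw [Finset.sum_add_distrib, hkappa, Finset.mul_sum]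
    _ ≤ _ := by
        have := mul_le_mul_of_nonneg_left hprod (by linarith : 0 ≤ 2 - eps)
        linarith

end PosetEntropy

theorem theorem3 (P : Type*) [Fintype P] [PartialOrder P] (hP : PosetEntropy.HasWidth P 2) :
    (Fintype.card P : ℝ) * PosetEntropy.graphEntropy (PosetEntropy.incompGraph P) ≤
        (2 - PosetEntropy.eps) * Real.logb 2 (PosetEntropy.numLinearExtensions P : ℝ) +
          PosetEntropy.eps * (PosetEntropy.kappaTwo P : ℝ) ∧
      |PosetEntropy.eps - 0.26| < 0.005 := by
  obtain ⟨col, hcol⟩ := hP.exists_coloring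
  exact ⟨PosetEntropy.card_mul_graphEntropy_le col hcol, PosetEntropy.abs_eps_sub_lt⟩
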